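/- **Setting.** Fix spaces $\mathcal X,\mathcal Y$ of plaintexts and outputs and a space $\mathcal F$ of functions $f:\mathcal X\to\mathcal Y$ (all depending on the security parameter $\lambda$, with elements represented by bit strings whose length depends only on $\lambda$). Let $\mathsf{PKFE}=(\mathsf{Setup},\mathsf{KG},\mathsf{Enc},\mathsf{Dec})$ be a public-key functional encryption scheme for $\mathcal X,\mathcal Y,\mathcal F$ with PPT algorithms, and let $\mathsf{SDE}=(\mathsf{Setup},\mathcal{QKG},\mathsf{Enc},\mathcal{D}ec)$ be a single-decryptor encryption scheme whose message space is the ciphertext space of $\mathsf{PKFE}$ ($\mathsf{Setup},\mathsf{Enc}$ are classical PPT; $\mathcal{QKG}$, which outputs a quantum key, and $\mathcal{D}ec$ are QPT). The nested single-decryptor functional encryption scheme $\mathsf{1SDFE}$ is: - $\mathsf{Setup}(1^\lambda)$: $(\mathsf{fe.pk},\mathsf{fe.msk})\gets\mathsf{PKFE.Setup}(1^\lambda)$, $(\mathsf{sde.pk},\mathsf{sde.sk})\gets\mathsf{SDE.Setup}(1^\lambda)$; output $\mathsf{pk}=(\mathsf{fe.pk},\mathsf{sde.pk})$, $\mathsf{msk}=(\mathsf{fe.msk},\mathsf{sde.sk})$.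 - $\mathcal{QKG}(\mathsf{msk},f)$: output $(\mathsf{fe.sk}_f,\mathit{dk})$ with $\mathsf{fe.sk}_f\gets\mathsf{PKFE.KG}(\mathsf{fe.msk},f)$ and $\mathit{dk}\gets\mathsf{SDE}.\mathcal{QKG}(\mathsf{sde.sk})$. - $\mathsf{Enc}(\mathsf{pk},x)$: output $\mathsf{SDE.Enc}(\mathsf{sde.pk},\mathsf{PKFE.Enc}(\mathsf{fe.pk},x))$. - $\mathcal{D}ec((\mathsf{fe.sk}_f,\mathit{dk}),\mathsf{ct})$: decrypt $\mathsf{ct}$ with $\mathit{dk}$, then decrypt the result with $\mathsf{fe.sk}_f$. **$\gamma$-good test.** A quantum decryptor is a pair $(q,U)$ of a quantum state $q$ and (the classical description of) a general quantum circuit $U$ that takes a ciphertext and $q$ and outputs a bit. Let $D$ be a distribution on pairs $(\mathsf{coin},\mathsf{ct})$. Let $P$ be the operator for which $\mathrm{Tr}(Pq)$ is the probability that $U$, run on $\mathsf{ct}$ and $q$ with $(\mathsf{coin},\mathsf{ct})\gets D$, outputs $\mathsf{coin}$. The test with respect to $D$ is the threshold implementation of $(P,I-P)$ with threshold $\frac12+\gamma$: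 measure $q$ with the spectral projections of $P$ and pass if the eigenvalue obtained is at least $\frac12+\gamma$. **SDE game with randomized function family $\mathcal G=\{\mathcal G_\lambda\}_\lambda$.** The challenger runs $(\mathsf{pk},\mathsf{sk})\gets\mathsf{Setup}(1^\lambda)$ and gives $\mathsf{pk}$ and $\mathit{dk}\gets\mathcal{QKG}(\mathsf{sk})$ to the adversary, who outputs inputs $m_0,m_1$ with $|m_0|=|m_1|$, a $g\in\mathcal G_\lambda$, and two decryptors $(q[R_1],U_1)$, $(q[R_2],U_2)$, where $q$ is a possibly entangled state on registers $R_1,R_2$. The adversary wins if both decryptors pass the $\gamma$-good test with respect to the distribution of $(\mathsf{coin},\mathsf{Enc}(\mathsf{pk},g(m_{\mathsf{coin}};r)))$ with uniform $\mathsf{coin}\in\{0,1\}$ and uniform $r$. $\mathsf{SDE}$ is *strong $\gamma$-anti-piracy secure with randomized function family $\mathcal G$* if every QPT adversary wins with negligible probability. **Challenge-only SDFE game.** The challenger runs $(\mathsf{pk},\mathsf{msk})\gets\mathsf{Setup}(1^\lambda)$ and gives $\mathsf{pk}$ to the adversary, who sends one query $f^*\in\mathcal F$, receives $\mathcal{QKG}(\mathsf{msk},f^*)$,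 and outputs $x_0,x_1\in\mathcal X$ with $f^*(x_0)\ne f^*(x_1)$ and two decryptors $(q[R_1],U_1)$, $(q[R_2],U_2)$ as above. The adversary wins if both decryptors pass the $\gamma$-good test with respect to the distribution of $(\mathsf{coin},\mathsf{Enc}(\mathsf{pk},x_{\mathsf{coin}}))$ with uniform $\mathsf{coin}\in\{0,1\}$. The scheme is *challenge-only strong $\gamma$-anti-piracy secure* if every QPT adversary wins with negligible probability. **Theorem.** Let $\gamma,\gamma':\mathbb N\to[0,1]$ with $\gamma'(\lambda)\le\gamma(\lambda)$ for all $\lambda$ (for instance $\gamma'=\gamma/4$ or $\gamma'=\gamma$). If $\mathsf{SDE}$ is strong $\gamma'$-anti-piracy secure with the randomized function family $\mathcal G_\lambda=\{\mathsf{PKFE.Enc}(\mathsf{fe.pk},\cdot\,;\cdot) : \mathsf{fe.pk}\text{ in the support of }\mathsf{PKFE.Setup}(1^\lambda)\}$ on inputs from $\mathcal X$, then $\mathsf{1SDFE}$ is challenge-only strong $\gamma$-anti-piracy secure. -/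

import Mathlib

open scoped BigOperators Kronecker

noncomputable section

namespace QCrypto

/-! ## Registers and circuits -/

/-- The shape of a register: a bracketed sequence of (qu)bits. -/
inductive Wires : Type
  | unit : Wires
  | bit : Wires
  | tensor : Wires → Wires → Wires

infixr:70 " ⊠ " => Wires.tensor

/-- The classical contents of a register, i.e. the bit strings of that shape. They index the
computational basis of the register. -/
@[reducible] def Wires.val : Wires → Type
  | .unit => Unit
  | .bit => Bool
  | .tensor a b => a.val × b.val

@[reducible] def Wires.valFintype : (w : Wires) → Fintype w.val
  | .unit => inferInstanceAs (Fintype Unit)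
  | .bit => inferInstanceAs (Fintype Bool)
  | .tensor a b => @instFintypeProd _ _ a.valFintype b.valFintype

@[reducible] def Wires.valDecEq : (w : Wires) → DecidableEq w.val
  | .unit => inferInstanceAs (DecidableEq Unit)
  | .bit => inferInstanceAs (DecidableEq Bool)
  | .tensor a b => @instDecidableEqProd _ _ a.valDecEq b.valDecEq

instance (w : Wires) : Fintype w.val := w.valFintype

instance (w : Wires) : DecidableEq w.val := w.valDecEq

/-- The number of (qu)bits of a register. -/
def Wires.width : Wires → ℕ
  | .unit => 0
  | .bit => 1
  | .tensor a b => a.width + b.width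

/-- The contents of a register as a flat bit string. -/
def Wires.toBits : (w : Wires) → w.val → List Bool
  | .unit, _ => []
  | .bit, b => [b]
  | .tensor a b, x => a.toBits x.1 ++ b.toBits x.2

/-- Circuits over a gate set `G`: gates composed in sequence and in parallel, with rewiring. -/
inductive Circ (G : Wires → Wires → Type) : Wires → Wires → Type
  | id (a : Wires) : Circ G a a
  | seq {a b c : Wires} (f : Circ G a b) (g : Circ G b c) : Circ G a c
  | par {a b c d : Wires} (f : Circ G a b) (g : Circ G c d) : Circ G (a ⊠ c) (b ⊠ d)
  | swap (a b : Wires) : Circ G (a ⊠ b) (b ⊠ a)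
  | assoc (a b c : Wires) : Circ G ((a ⊠ b) ⊠ c) (a ⊠ (b ⊠ c))
  | assocInv (a b c : Wires) : Circ G (a ⊠ (b ⊠ c)) ((a ⊠ b) ⊠ c)
  | unitL (a : Wires) : Circ G (Wires.unit ⊠ a) a
  | unitLInv (a : Wires) : Circ G a (Wires.unit ⊠ a)
  | gate {a b : Wires} (g : G a b) : Circ G a b

/-- The number of elementary gates of a circuit, for a given cost of each gate. -/
def Circ.sizeWith {G : Wires → Wires → Type} (cost : ∀ a b, G a b → ℕ) :
    {a b : Wires} → Circ G a b → ℕ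
  | _, _, .seq f g => f.sizeWith cost + g.sizeWith cost
  | _, _, .par f g => f.sizeWith cost + g.sizeWith cost
  | a, b, .gate g => cost a b g
  | _, _, _ => 0

/-- The description of a circuit as a bit string. It is a prefix code: the shape of the input
register and the string determine the circuit. -/
def Circ.codeWith {G : Wires → Wires → Type} (gcode : ∀ a b, G a b → List Bool) :
    {a b : Wires} → Circ G a b → List Bool
  | _, _, .id _ => [false, false, false, false]
  | _, _, .seq f g => [false, false, false, true] ++ (f.codeWith gcode ++ g.codeWith gcode)
  | _, _, .par f g => [false, false, true, false] ++ (f.codeWith gcode ++ g.codeWith gcode)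
  | _, _, .swap _ _ => [false, false, true, true]
  | _, _, .assoc _ _ _ => [false, true, false, false]
  | _, _, .assocInv _ _ _ => [false, true, false, true]
  | _, _, .unitL _ => [false, true, true, false]
  | _, _, .unitLInv _ => [false, true, true, true]
  | a, b, .gate g => [true, false, false, false] ++ gcode a b g

/-! ### Boolean circuits -/

/-- Boolean gates; `dup` and `drop` copy and erase a whole register, bit by bit. -/
inductive BGate : Wires → Wires → Type
  | nand : BGate (Wires.bit ⊠ Wires.bit) Wires.bit
  | const (v : Bool) : BGate Wires.unit Wires.bit
  | dup (w : Wires) : BGate w (w ⊠ w)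
  | drop (w : Wires) : BGate w Wires.unit

abbrev BCirc : Wires → Wires → Type := Circ BGate

def BGate.eval : {a b : Wires} → BGate a b → a.val → b.val
  | _, _, .nand => fun x => !(x.1 && x.2)
  | _, _, .const v => fun _ => v
  | _, _, .dup _ => fun x => (x, x)
  | _, _, .drop _ => fun _ => ()

def BGate.cost : (a b : Wires) → BGate a b → ℕ
  | _, _, .nand => 1
  | _, _, .const _ => 1
  | _, _, .dup w => w.width
  | _, _, .drop w => w.width

def BGate.code : (a b : Wires) → BGate a b → List Bool
  | _, _, .nand => [false, false]
  | _, _, .const v => [false, true, v]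
  | _, _, .dup _ => [true, false]
  | _, _, .drop _ => [true, true]

/-- The function computed by a Boolean circuit. -/
def BCirc.eval : {a b : Wires} → BCirc a b → a.val → b.val
  | _, _, .id _ => fun x => x
  | _, _, .seq f g => fun x => BCirc.eval g (BCirc.eval f x)
  | _, _, .par f g => fun x => (BCirc.eval f x.1, BCirc.eval g x.2)
  | _, _, .swap _ _ => fun x => (x.2, x.1)
  | _, _, .assoc _ _ _ => fun x => (x.1.1, (x.1.2, x.2))
  | _, _, .assocInv _ _ _ => fun x => ((x.1, x.2.1), x.2.2)
  | _, _, .unitL _ => fun x => x.2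
  | _, _, .unitLInv _ => fun x => ((), x)
  | _, _, .gate g => g.eval

/-! ### General quantum circuits -/

/-- Gates of general quantum circuits: a universal set of unitary gates, a fair coin, and
`classical c`, which measures its input register in the computational basis and runs the Boolean
circuit `c` on the outcome (so measuring, preparing and discarding qubits are special cases). -/
inductive QGate : Wires → Wires → Type
  | hadamard : QGate Wires.bit Wires.bit
  | phase : QGate Wires.bit Wires.bit
  | cnot : QGate (Wires.bit ⊠ Wires.bit) (Wires.bit ⊠ Wires.bit)
  | coin : QGate Wires.unit Wires.bit
  | classical {a b : Wires} (c : BCirc a b) : QGate a b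

abbrev QCirc : Wires → Wires → Type := Circ QGate

def QGate.cost : (a b : Wires) → QGate a b → ℕ
  | a, _, .classical c => a.width + c.sizeWith BGate.cost
  | _, _, _ => 1

def QGate.code : (a b : Wires) → QGate a b → List Bool
  | _, _, .hadamard => [false, false, false]
  | _, _, .phase => [false, false, true]
  | _, _, .cnot => [false, true, false]
  | _, _, .coin => [false, true, true]
  | _, _, .classical c => [true, false, false] ++ c.codeWith BGate.code

abbrev QCirc.size {a b : Wires} (C : QCirc a b) : ℕ := C.sizeWith QGate.cost

abbrev QCirc.code {a b : Wires} (C : QCirc a b) : List Bool := C.codeWith QGate.code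

theorem Circ.codeWith_inj {G : Wires → Wires → Type} (gc : ∀ a b, G a b → List Bool)
    (hg : ∀ a b (g : G a b) b' (g' : G a b') s s', gc a b g ++ s = gc a b' g' ++ s' →
      b = b' ∧ HEq g g' ∧ s = s') :
    ∀ {a b} (c : Circ G a b) {b'} (c' : Circ G a b') (s s' : List Bool),
      c.codeWith gc ++ s = c'.codeWith gc ++ s' → b = b' ∧ HEq c c' ∧ s = s' := by
  intro a b c
  induction c with
  | seq f g ihf ihg =>
    intro b' c' s s' h
    cases c' <;> simp [Circ.codeWith] at h
    rename_i m f' g'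
    obtain ⟨rfl, h1, h2⟩ := ihf f' _ _ h
    obtain rfl := eq_of_heq h1
    obtain ⟨rfl, h3, h4⟩ := ihg g' _ _ h2
    obtain rfl := eq_of_heq h3
    exact ⟨rfl, HEq.rfl, h4⟩
  | par f g ihf ihg =>
    intro b' c' s s' h
    cases c' <;> simp [Circ.codeWith] at h
    rename_i f' g'
    obtain ⟨rfl, h1, h2⟩ := ihf f' _ _ h
    obtain rfl := eq_of_heq h1
    obtain ⟨rfl, h3, h4⟩ := ihg g' _ _ h2
    obtain rfl := eq_of_heq h3
    exact ⟨rfl, HEq.rfl, h4⟩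
  | gate g =>
    intro b' c' s s' h
    cases c' <;> simp [Circ.codeWith] at h
    obtain ⟨rfl, h1, h2⟩ := hg _ _ _ _ _ _ _ h
    obtain rfl := eq_of_heq h1
    exact ⟨rfl, HEq.rfl, h2⟩
  | _ =>
    intro b' c' s s' h
    cases c' <;> simp [Circ.codeWith] at h
    all_goals exact ⟨rfl, HEq.rfl, h⟩

theorem BGate.code_inj : ∀ a b (g : BGate a b) b' (g' : BGate a b') s s',
    BGate.code a b g ++ s = BGate.code a b' g' ++ s' → b = b' ∧ HEq g g' ∧ s = s' := by
  intro a b g b' g' s s' h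
  cases g <;> cases g' <;> simp [BGate.code] at h
  all_goals first | exact ⟨rfl, HEq.rfl, h⟩ | (obtain ⟨rfl, rfl⟩ := h; exact ⟨rfl, HEq.rfl, rfl⟩)

theorem QGate.code_inj : ∀ a b (g : QGate a b) b' (g' : QGate a b') s s',
    QGate.code a b g ++ s = QGate.code a b' g' ++ s' → b = b' ∧ HEq g g' ∧ s = s' := by
  intro a b g b' g' s s' h
  cases g with
  | classical c =>
    cases g' <;> simp [QGate.code] at h
    rename_i c'
    obtain ⟨rfl, h1, h2⟩ := Circ.codeWith_inj _ BGate.code_inj c c' _ _ h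
    obtain rfl := eq_of_heq h1
    exact ⟨rfl, HEq.rfl, h2⟩
  | _ =>
    cases g' <;> simp [QGate.code] at h
    all_goals exact ⟨rfl, HEq.rfl, h⟩

/-- A bit string describes at most one circuit with given input and output registers. -/
theorem QCirc.code_unique {a b : Wires} (U U' : QCirc a b) (s : List Bool) (h : U.code <+: s)
    (h' : U'.code <+: s) : U = U' := by
  obtain ⟨t, rfl⟩ := h
  obtain ⟨t', h'⟩ := h'
  exact eq_of_heq (Circ.codeWith_inj _ QGate.code_inj U U' _ _ h'.symm).2.1

/-- Operators on (the Hilbert space of) a register, in particular its density matrices. -/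
abbrev Op (w : Wires) : Type := Matrix w.val w.val ℂ

/-- The state `|x⟩⟨x|`. -/
def ket {w : Wires} (x : w.val) : Op w := Matrix.single x x 1

/-- The map `Φ ⊗ id`. -/
def onLeft {α β κ : Type} (Φ : Matrix α α ℂ → Matrix β β ℂ) (ρ : Matrix (α × κ) (α × κ) ℂ) :
    Matrix (β × κ) (β × κ) ℂ :=
  Matrix.of fun p q => Φ (Matrix.of fun i j => ρ (i, p.2) (j, q.2)) p.1 q.1

/-- The map `id ⊗ Φ`. -/
def onRight {α β κ : Type} (Φ : Matrix α α ℂ → Matrix β β ℂ) (ρ : Matrix (κ × α) (κ × α) ℂ) :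
    Matrix (κ × β) (κ × β) ℂ :=
  Matrix.of fun p q => Φ (Matrix.of fun i j => ρ (p.1, i) (q.1, j)) p.2 q.2

def hadamardMatrix : Matrix Bool Bool ℂ :=
  Matrix.of fun x y => ((Real.sqrt 2 : ℝ) : ℂ)⁻¹ * (if x && y then -1 else 1)

def phaseMatrix : Matrix Bool Bool ℂ :=
  Matrix.diagonal fun x => if x then Complex.exp (Complex.I * (Real.pi / 4 : ℝ)) else 1

def QGate.denote : {a b : Wires} → QGate a b → Op a → Op b
  | _, _, .hadamard => fun ρ => hadamardMatrix * ρ * hadamardMatrix.conjTranspose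
  | _, _, .phase => fun ρ => phaseMatrix * ρ * phaseMatrix.conjTranspose
  | _, _, .cnot => fun ρ =>
      Matrix.submatrix ρ (fun x => (x.1, xor x.1 x.2)) (fun x => (x.1, xor x.1 x.2))
  | _, _, .coin => fun ρ => Matrix.diagonal fun _ => ρ () () / 2
  | _, _, .classical c => fun ρ =>
      Matrix.diagonal fun y => ∑ x, if c.eval x = y then ρ x x else 0

/-- The quantum operation performed by a general quantum circuit. -/
def QCirc.denote : {a b : Wires} → QCirc a b → Op a → Op b
  | _, _, .id _ => fun ρ => ρ
  | _, _, .seq f g => fun ρ => QCirc.denote g (QCirc.denote f ρ)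
  | _, _, .par f g => fun ρ => onRight (QCirc.denote g) (onLeft (QCirc.denote f) ρ)
  | _, _, .swap _ _ => fun ρ => Matrix.submatrix ρ (fun x => (x.2, x.1)) (fun x => (x.2, x.1))
  | _, _, .assoc _ _ _ => fun ρ =>
      Matrix.submatrix ρ (fun x => ((x.1, x.2.1), x.2.2)) (fun x => ((x.1, x.2.1), x.2.2))
  | _, _, .assocInv _ _ _ => fun ρ =>
      Matrix.submatrix ρ (fun x => (x.1.1, (x.1.2, x.2))) (fun x => (x.1.1, (x.1.2, x.2)))
  | _, _, .unitL _ => fun ρ => Matrix.submatrix ρ (fun x => ((), x)) (fun x => ((), x))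
  | _, _, .unitLInv _ => fun ρ => Matrix.submatrix ρ (fun x => x.2) (fun x => x.2)
  | _, _, .gate g => g.denote

/-! ## Efficient algorithms -/

/-- A quantum polynomial-time algorithm: a family of general quantum circuits of polynomial size
whose descriptions are computed by a deterministic polynomial-time Turing machine on input `1ⁿ`. -/
def IsQPT {a b : ℕ → Wires} (C : ∀ n, QCirc (a n) (b n)) : Prop :=
  (∃ p : Polynomial ℕ, ∀ n, (a n).width + (C n).size ≤ p.eval n) ∧
    Nonempty (Turing.TM2ComputableInPolyTime Computability.unaryEncodeNat
      (fun l : List Bool => l) (fun n => (C n).code))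

/-- Fill a register with independent fair coins. -/
def coins : (w : Wires) → QCirc Wires.unit w
  | .unit => .id _
  | .bit => .gate .coin
  | .tensor a b => .seq (.unitLInv _) (.par (coins a) (coins b))

/-- Draw the random string `r` uniformly and run a Boolean circuit on the input and `r`. -/
def sample {a r b : Wires} (c : BCirc (a ⊠ r) b) : QCirc a b :=
  .seq (.seq (.unitLInv a) (.swap _ _)) (.seq (.par (.id a) (coins r)) (.gate (.classical c)))

/-- The randomized function family `f`, with explicit random input, is computed by a classical
probabilistic polynomial-time algorithm. -/
def IsPPT {a r b : ℕ → Wires} (f : ∀ n, (a n).val → (r n).val → (b n).val) : Prop :=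
  ∃ c : ∀ n, BCirc (a n ⊠ r n) (b n),
    (∀ n x s, (c n).eval (x, s) = f n x s) ∧ IsQPT fun n => sample (c n)

/-- Representation of `{⊥} ∪ w` by a flag and a string. -/
def toOption {w : Wires} (x : (Wires.bit ⊠ w).val) : Option w.val :=
  if x.1 then some x.2 else none

/-- A function of the security parameter is negligible. -/
def Negligible (f : ℕ → ℝ) : Prop :=
  Asymptotics.SuperpolynomialDecay Filter.atTop (fun n : ℕ => (n : ℝ)) f

/-! ## Threshold implementation -/

/-- The projective implementation of the binary POVM `(P, I - P)`: the projective measurement whose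
outcome is the distribution `(p, 1 - p)`, `p` an eigenvalue of `P`, and whose projection for this
outcome is the spectral projection of `P` onto the eigenspace of `p`. -/
def projImp {w : Wires} (P : Op w) (p : ℝ) : Op w :=
  cfc (fun x : ℝ => if x = p then (1 : ℝ) else 0) P

/-- The threshold implementation of `(P, I - P)`: apply the projective implementation, and accept
if the outcome `(p, 1 - p)` has `p ≥ t`. This is the projection onto the accepting outcome. -/
def thresholdImp {w : Wires} (t : ℝ) (P : Op w) : Op w :=
  ∑ p ∈ (P.finite_real_spectrum).toFinset, if t ≤ p then projImp P p else 0

/-! ## Quantum decryptors and their test -/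

/-- Given the quantum decryptor `(q, U)`, the positive operator `E` with
`Tr (E q) = Pr[U outputs v on input ciphertext ct and state q]`. -/
def decryptorOp {c R : Wires} (U : QCirc (c ⊠ R) Wires.bit) (ct : c.val) (v : Bool) : Op R :=
  Matrix.of fun i j => U.denote (Matrix.single (ct, j) (ct, i) 1) v v

/-- The mixture, over a uniform `ω`, of the measurements "run the decryptor on the ciphertext
`(D ω).2` and accept if it outputs the bit `(D ω).1`" (accepting element of the binary POVM). -/
def mixture {Ω : Type} [Fintype Ω] {c R : Wires} (D : Ω → Bool × c.val)
    (U : QCirc (c ⊠ R) Wires.bit) : Op R :=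
  (Fintype.card Ω : ℂ)⁻¹ • ∑ ω, decryptorOp U (D ω).2 (D ω).1

/-- The circuit described by a (padded) bit string, if any. The padding has to make the string at
least as long as the circuit is large, so that polynomially long strings describe circuits of
polynomial size. -/
def decodeCirc {a b : Wires} (s : List Bool) : Option (QCirc a b) :=
  open Classical in
  if h : ∃ U : QCirc a b, U.code <+: s ∧ U.size ≤ s.length then some h.choose else none

/-- The projection onto passing the `γ`-good test, where ciphertexts and coins are distributed
according to `D` and the circuit of the decryptor is described by `s`. -/
def testProj {Ω : Type} [Fintype Ω] {c : Wires} (R : Wires) (γ : ℝ) (D : Ω → Bool × c.val)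
    (s : List Bool) : Op R :=
  match (decodeCirc s : Option (QCirc (c ⊠ R) Wires.bit)) with
  | some U => thresholdImp (1 / 2 + γ) (mixture D U)
  | none => 0

/-- The (unnormalized) state of the register `b` after measuring the register `a` with outcome
`x`. -/
def condOn {a b : Wires} (ρ : Op (a ⊠ b)) (x : a.val) : Op b :=
  Matrix.submatrix ρ (fun y => (x, y)) (fun y => (x, y))

/-- The probability that both tests pass on the two registers of `q`. -/
def bothPass {R₁ R₂ : Wires} (T₁ : Op R₁) (T₂ : Op R₂) (q : Op (R₁ ⊠ R₂)) : ℝ :=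
  (Matrix.trace ((T₁ ⊗ₖ T₂ : Op (R₁ ⊠ R₂)) * q)).re

/-- Average of a real function over a uniformly random string. -/
def avg {w : Wires} (f : w.val → ℝ) : ℝ := (Fintype.card w.val : ℝ)⁻¹ * ∑ r, f r

/-! ## Schemes -/

/-- A plaintext space `𝒳`, an output space `𝒴` and a function space `ℱ`, given by their string
representations for each security parameter. -/
structure FunClass where
  X : ℕ → Wires
  Y : ℕ → Wires
  F : ℕ → Wires
  plaintexts : ∀ n, Set (X n).val
  functions : ∀ n, Set (F n).val
  eval : ∀ n, (F n).val → (X n).val → (Y n).val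

/-- The algorithms of a public-key functional encryption scheme with ciphertexts in `C`. -/
structure PKFE (𝓕 : FunClass) (C : ℕ → Wires) where
  pk : ℕ → Wires
  msk : ℕ → Wires
  sk : ℕ → Wires
  setupRand : ℕ → Wires
  kgRand : ℕ → Wires
  encRand : ℕ → Wires
  decRand : ℕ → Wires
  setup : ∀ n, (setupRand n).val → (pk n).val × (msk n).val
  kg : ∀ n, (msk n).val → (𝓕.F n).val → (kgRand n).val → (sk n).val
  enc : ∀ n, (pk n).val → (𝓕.X n).val → (encRand n).val → (C n).val
  dec : ∀ n, (sk n).val → (C n).val → (decRand n).val → Option (𝓕.Y n).val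

/-- All algorithms of the scheme are PPT. -/
structure PKFE.IsEfficient {𝓕 : FunClass} {C : ℕ → Wires} (S : PKFE 𝓕 C) : Prop where
  setup : IsPPT (a := fun _ => Wires.unit) (b := fun n => S.pk n ⊠ S.msk n)
    fun n _ r => S.setup n r
  kg : IsPPT (a := fun n => S.msk n ⊠ 𝓕.F n) fun n x r => S.kg n x.1 x.2 r
  enc : IsPPT (a := fun n => S.pk n ⊠ 𝓕.X n) fun n x r => S.enc n x.1 x.2 r
  dec : ∃ d : ∀ n, (S.sk n ⊠ C n).val → (S.decRand n).val → (Wires.bit ⊠ 𝓕.Y n).val,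
    IsPPT d ∧ ∀ n k c r, S.dec n k c r = toOption (d n (k, c) r)

/-- The algorithms of a single-decryptor encryption scheme with messages in `M`. The quantum key
generation outputs a density matrix on the register `dk`. Decryption of a ciphertext is the
measurement (POVM) on `dk` with outcomes in `{⊥} ∪ M`. -/
structure SDE (M : ℕ → Wires) where
  pk : ℕ → Wires
  sk : ℕ → Wires
  dk : ℕ → Wires
  ct : ℕ → Wires
  setupRand : ℕ → Wires
  encRand : ℕ → Wires
  setup : ∀ n, (setupRand n).val → (pk n).val × (sk n).val
  qkg : ∀ n, (sk n).val → Op (dk n)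
  enc : ∀ n, (pk n).val → (M n).val → (encRand n).val → (ct n).val
  dec : ∀ n, (ct n).val → Option (M n).val → Op (dk n)

/-- Setup and encryption are PPT, key generation and decryption are QPT. -/
structure SDE.IsEfficient {M : ℕ → Wires} (S : SDE M) : Prop where
  setup : IsPPT (a := fun _ => Wires.unit) (b := fun n => S.pk n ⊠ S.sk n)
    fun n _ r => S.setup n r
  qkg : ∃ Q : ∀ n, QCirc (S.sk n) (S.dk n), IsQPT Q ∧ ∀ n k, (Q n).denote (ket k) = S.qkg n k
  enc : IsPPT (a := fun n => S.pk n ⊠ M n) fun n x r => S.enc n x.1 x.2 r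
  dec : ∃ Q : ∀ n, QCirc (S.ct n ⊠ S.dk n) (Wires.bit ⊠ M n), IsQPT Q ∧
    ∀ n c (m : Option (M n).val), S.dec n c m = Matrix.of fun i j =>
      ∑ x, if toOption x = m then (Q n).denote (Matrix.single (c, j) (c, i) 1) x x else 0

/-- The algorithms of a single-decryptor functional encryption scheme; the conventions are those
of `SDE`. -/
structure SDFE (𝓕 : FunClass) where
  pk : ℕ → Wires
  msk : ℕ → Wires
  sk : ℕ → Wires
  ct : ℕ → Wires
  setupRand : ℕ → Wires
  encRand : ℕ → Wires
  setup : ∀ n, (setupRand n).val → (pk n).val × (msk n).val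
  qkg : ∀ n, (msk n).val → (𝓕.F n).val → Op (sk n)
  enc : ∀ n, (pk n).val → (𝓕.X n).val → (encRand n).val → (ct n).val
  dec : ∀ n, (ct n).val → Option (𝓕.Y n).val → Op (sk n)

/-- The nested scheme: a PKFE ciphertext is encrypted under SDE. -/
def nested {𝓕 : FunClass} {C : ℕ → Wires} (fe : PKFE 𝓕 C) (sde : SDE C) : SDFE 𝓕 where
  pk n := fe.pk n ⊠ sde.pk n
  msk n := fe.msk n ⊠ sde.sk n
  sk n := fe.sk n ⊠ sde.dk n
  ct n := sde.ct n
  setupRand n := fe.setupRand n ⊠ sde.setupRand n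
  encRand n := fe.encRand n ⊠ sde.encRand n
  setup n r :=
    (((fe.setup n r.1).1, (sde.setup n r.2).1), ((fe.setup n r.1).2, (sde.setup n r.2).2))
  qkg n msk f :=
    (Fintype.card (fe.kgRand n).val : ℂ)⁻¹ •
      ∑ r, (ket (fe.kg n msk.1 f r) ⊗ₖ sde.qkg n msk.2 : Op (fe.sk n ⊠ sde.dk n))
  enc n pk x r := sde.enc n pk.2 (fe.enc n pk.1 x r.1) r.2
  dec n ct y :=
    ∑ k, ∑ m : Option (C n).val,
      ((Fintype.card (fe.decRand n).val : ℂ)⁻¹ *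
          ∑ r, if (m.bind fun c => fe.dec n k c r) = y then (1 : ℂ) else 0) •
        (ket k ⊗ₖ sde.dec n ct m : Op (fe.sk n ⊠ sde.dk n))

/-! ## Strong anti-piracy security of SDE for randomized messages -/

/-- A family `𝒢` of randomized functions `g(· ; ·)` with values in `M`. The functions of `𝒢ₙ` are
described by the strings in `keys n`. -/
structure RandFamily (M : ℕ → Wires) where
  key : ℕ → Wires
  dom : ℕ → Wires
  rand : ℕ → Wires
  keys : ∀ n, Set (key n).val
  inputs : ∀ n, Set (dom n).val
  eval : ∀ n, (key n).val → (dom n).val → (rand n).val → (M n).val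

/-- The family `{PKFE.Enc(fe.pk, · ; ·)}`, `fe.pk` in the support of the setup algorithm. -/
def PKFE.encFamily {𝓕 : FunClass} {C : ℕ → Wires} (fe : PKFE 𝓕 C) : RandFamily C where
  key := fe.pk
  dom := 𝓕.X
  rand := fe.encRand
  keys n := {pk | ∃ r, (fe.setup n r).1 = pk}
  inputs := 𝓕.plaintexts
  eval := fe.enc

/-- The distribution of `(coin, Enc(pk, g(m_coin; r)))`, with explicit randomness. -/
def SDE.challenge {M : ℕ → Wires} (S : SDE M) (g : RandFamily M) (n : ℕ) (pk : (S.pk n).val)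
    (k : (g.key n).val) (m₀ m₁ : (g.dom n).val)
    (ω : Bool × (g.rand n).val × (S.encRand n).val) : Bool × (S.ct n).val :=
  (ω.1, S.enc n pk (g.eval n k (if ω.1 then m₁ else m₀) ω.2.1) ω.2.2)

/-- An adversary: given `(pk, dk)` it outputs `(m₀, m₁)`, (the description of) `g`, descriptions
of the circuits of two decryptors, and a joint state of their registers `R₁`, `R₂`. -/
structure SDEPirate {M : ℕ → Wires} (S : SDE M) (g : RandFamily M) where
  d₁ : ℕ → Wires
  d₂ : ℕ → Wires
  R₁ : ℕ → Wires
  R₂ : ℕ → Wires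
  run : ∀ n, QCirc (S.pk n ⊠ S.dk n)
    ((g.dom n ⊠ g.dom n ⊠ g.key n ⊠ d₁ n ⊠ d₂ n) ⊠ (R₁ n ⊠ R₂ n))

open Classical in
/-- The probability that the adversary wins the strong `γ`-anti-piracy game with randomized
function family `g`. -/
def SDEPirate.winProb {M : ℕ → Wires} {S : SDE M} {g : RandFamily M} (A : SDEPirate S g)
    (n : ℕ) (γ : ℝ) : ℝ :=
  avg fun r : (S.setupRand n).val =>
    let pk := (S.setup n r).1
    let ρ := (A.run n).denote (ket pk ⊗ₖ S.qkg n (S.setup n r).2)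
    ∑ o : (g.dom n ⊠ g.dom n ⊠ g.key n ⊠ A.d₁ n ⊠ A.d₂ n).val,
      match o with
      | (m₀, m₁, k, s₁, s₂) =>
        if m₀ ∈ g.inputs n ∧ m₁ ∈ g.inputs n ∧ k ∈ g.keys n then
          bothPass
            (testProj (A.R₁ n) γ (S.challenge g n pk k m₀ m₁) ((A.d₁ n).toBits s₁))
            (testProj (A.R₂ n) γ (S.challenge g n pk k m₀ m₁) ((A.d₂ n).toBits s₂))
            (condOn ρ (m₀, m₁, k, s₁, s₂))
        else 0

/-- Strong `γ`-anti-piracy security with randomized function family `g`. -/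
def SDE.StrongAntiPiracyRand {M : ℕ → Wires} (S : SDE M) (g : RandFamily M) (γ : ℕ → ℝ) : Prop :=
  ∀ A : SDEPirate S g, IsQPT A.run → Negligible fun n => A.winProb n (γ n)

/-! ## Challenge-only strong anti-piracy security of SDFE -/

/-- The distribution of `(coin, Enc(pk, x_coin))`, with explicit randomness. -/
def SDFE.challenge {𝓕 : FunClass} (S : SDFE 𝓕) (n : ℕ) (pk : (S.pk n).val)
    (x₀ x₁ : (𝓕.X n).val) (ω : Bool × (S.encRand n).val) : Bool × (S.ct n).val :=
  (ω.1, S.enc n pk (if ω.1 then x₁ else x₀) ω.2)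

/-- A challenge-only adversary: given `pk` it outputs the challenge query `f*` and keeps a quantum
state; given the functional key for `f*` as well, it outputs `(x₀, x₁)`, descriptions of the
circuits of two decryptors, and a joint state of their registers `R₁`, `R₂`. -/
structure SDFEPirate {𝓕 : FunClass} (S : SDFE 𝓕) where
  st : ℕ → Wires
  d₁ : ℕ → Wires
  d₂ : ℕ → Wires
  R₁ : ℕ → Wires
  R₂ : ℕ → Wires
  query : ∀ n, QCirc (S.pk n) (𝓕.F n ⊠ st n)
  run : ∀ n, QCirc (st n ⊠ S.sk n) ((𝓕.X n ⊠ 𝓕.X n ⊠ d₁ n ⊠ d₂ n) ⊠ (R₁ n ⊠ R₂ n))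

open Classical in
/-- The probability that the adversary wins the challenge-only strong `γ`-anti-piracy game. -/
def SDFEPirate.winProb {𝓕 : FunClass} {S : SDFE 𝓕} (A : SDFEPirate S) (n : ℕ) (γ : ℝ) : ℝ :=
  avg fun r : (S.setupRand n).val =>
    let pk := (S.setup n r).1
    let ρ := (A.query n).denote (ket pk)
    ∑ f : (𝓕.F n).val,
      let ρ' := (A.run n).denote (condOn ρ f ⊗ₖ S.qkg n (S.setup n r).2 f)
      ∑ o : (𝓕.X n ⊠ 𝓕.X n ⊠ A.d₁ n ⊠ A.d₂ n).val,
        match o with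
        | (x₀, x₁, s₁, s₂) =>
          if f ∈ 𝓕.functions n ∧ x₀ ∈ 𝓕.plaintexts n ∧ x₁ ∈ 𝓕.plaintexts n ∧
              𝓕.eval n f x₀ ≠ 𝓕.eval n f x₁ then
            bothPass
              (testProj (A.R₁ n) γ (S.challenge n pk x₀ x₁) ((A.d₁ n).toBits s₁))
              (testProj (A.R₂ n) γ (S.challenge n pk x₀ x₁) ((A.d₂ n).toBits s₂))
              (condOn ρ' (x₀, x₁, s₁, s₂))
          else 0

/-- Challenge-only strong `γ`-anti-piracy security. -/
def SDFE.ChallengeOnlyStrongAntiPiracy {𝓕 : FunClass} (S : SDFE 𝓕) (γ : ℕ → ℝ) : Prop :=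
  ∀ A : SDFEPirate S, IsQPT A.query → IsQPT A.run → Negligible fun n => A.winProb n (γ n)

end QCrypto

end

/-!
Given a pirate against the nested scheme, the reduction to the security of the single-decryptor
scheme generates the functional encryption keys itself. With them it simulates the first stage of
the pirate, measures the query `f`, answers it with a functional key for `f` and the quantum key
that it has been given, and returns the output of the pirate together with `fe.pk`, the description
of the function `PKFE.Enc(fe.pk, · ; ·)`. Both games then test the same decryptors on the same
distribution, and the spectral projection to the eigenvalues that are at least `1/2 + γ` decreases
in `γ`, so that the reduction wins at least as often as the pirate.

The reduction is efficient only if the description of its circuit can be computed in polynomial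
time. This description is a concatenation of constant strings and of the descriptions of the
circuits that it is composed of, which is why the class of strings computable in polynomial time
has to be closed under concatenation.
-/

noncomputable section

namespace QCrypto

/-- Growth at most polynomial in the security parameter. -/
def PolyBounded (f : ℕ → ℕ) : Prop := ∃ p : Polynomial ℕ, ∀ n, f n ≤ p.eval n

section PolyBounded

variable {f g : ℕ → ℕ}

theorem PolyBounded.mono (hg : PolyBounded g) (h : ∀ n, f n ≤ g n) : PolyBounded f :=
  hg.imp fun _ hp n => (h n).trans (hp n)

theorem PolyBounded.const (c : ℕ) : PolyBounded fun _ => c :=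
  ⟨Polynomial.C c, fun n => by rw [Polynomial.eval_C]⟩

theorem PolyBounded.id : PolyBounded fun n => n :=
  ⟨Polynomial.X, fun n => by rw [Polynomial.eval_X]⟩

theorem PolyBounded.add (hf : PolyBounded f) (hg : PolyBounded g) :
    PolyBounded fun n => f n + g n := by
  obtain ⟨p, hp⟩ := hf
  obtain ⟨q, hq⟩ := hg
  exact ⟨p + q, fun n => by rw [Polynomial.eval_add]; exact add_le_add (hp n) (hq n)⟩

theorem PolyBounded.mul (hf : PolyBounded f) (hg : PolyBounded g) :
    PolyBounded fun n => f n * g n := by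
  obtain ⟨p, hp⟩ := hf
  obtain ⟨q, hq⟩ := hg
  exact ⟨p * q, fun n => by rw [Polynomial.eval_mul]; exact Nat.mul_le_mul (hp n) (hq n)⟩

end PolyBounded

/-! ## Runs of stack machines -/

section StackMachines

open Turing Turing.TM2 Turing.TM2.Stmt Function

section Steps

variable {K Λ σ : Type} {Γ : K → Type} [DecidableEq K] {M : Λ → Stmt Γ Λ σ}
  {m n : ℕ} {c d e : Cfg Γ Λ σ}

/-- The configuration `d` is reached from `c` in exactly `n` steps of the machine `M`. -/
def Steps (M : Λ → Stmt Γ Λ σ) (n : ℕ) (c d : Cfg Γ Λ σ) : Prop :=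
  (flip bind (step M))^[n] (some c) = some d

theorem Steps.head {l : Λ} {v : σ} {S : ∀ k, List (Γ k)} (h : Steps M n (stepAux (M l) v S) d) :
    Steps M (n + 1) ⟨some l, v, S⟩ d :=
  h

theorem Steps.trans (h : Steps M m c d) (h' : Steps M n d e) : Steps M (m + n) c e := by
  rw [Steps, add_comm, iterate_add_apply, h]
  exact h'

theorem steps_succ_iff : Steps M (n + 1) c e ↔ ∃ d, Steps M n c d ∧ e ∈ step M d := by
  rw [Steps, iterate_succ_apply']
  exact Option.bind_eq_some_iff

theorem exists_eq_of_mem_step (h : d ∈ step M c) :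
    ∃ l, c.l = some l ∧ d = stepAux (M l) c.var c.stk := by
  obtain ⟨_ | l, v, S⟩ := c
  · cases h
  · exact ⟨l, rfl, (Option.some.inj h).symm⟩

/-- The number of push instructions of a statement, which bounds the growth of each stack when the
statement is executed once. -/
def pushes : Stmt Γ Λ σ → ℕ
  | push _ _ q => pushes q + 1
  | peek _ _ q => pushes q
  | pop _ _ q => pushes q
  | load _ q => pushes q
  | branch _ q₁ q₂ => pushes q₁ + pushes q₂
  | goto _ => 0
  | halt => 0

theorem length_stepAux_le (k : K) (q : Stmt Γ Λ σ) (v : σ) (S : ∀ k, List (Γ k)) :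
    ((stepAux q v S).stk k).length ≤ (S k).length + pushes q := by
  induction q generalizing v S with
  | push j f q ih =>
    refine (ih _ _).trans ?_
    rcases eq_or_ne k j with rfl | h
    · simp only [update_self, List.length_cons, pushes]; omega
    · simp only [update_of_ne h, pushes]; omega
  | peek _ _ _ ih => exact ih _ _
  | pop j f q ih =>
    refine (ih _ _).trans ?_
    rcases eq_or_ne k j with rfl | h
    · simp [pushes]
    · simp [pushes, h]
  | load _ _ ih => exact ih _ _
  | branch f q₁ q₂ ih₁ ih₂ =>
    rw [stepAux, pushes]
    cases f v
    · exact (ih₂ _ _).trans (by omega)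
    · exact (ih₁ _ _).trans (by omega)
  | goto f => simp [pushes]
  | halt => simp [pushes]

theorem Steps.length_le (h : Steps M n c d) {N : ℕ} (hN : ∀ l, pushes (M l) ≤ N) (k : K) :
    (d.stk k).length ≤ (c.stk k).length + n * N := by
  induction n generalizing d with
  | zero => obtain rfl := Option.some.inj h; omega
  | succ n ih =>
    obtain ⟨d, hcd, hd⟩ := steps_succ_iff.1 h
    obtain ⟨l, -, rfl⟩ := exists_eq_of_mem_step hd
    have hstep := length_stepAux_le k (M l) d.var d.stk
    have hl := hN l
    have hd := ih hcd
    rw [Nat.succ_mul]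
    omega

end Steps

/-! ## Embedding one machine into another -/

section Embed

variable {K K' Λ Λ' σ σ' : Type} [DecidableEq K] [DecidableEq K'] {ι : K → K'} {Γ : K' → Type}
  {lab : Λ → Λ'} {exit : Λ'} {i : σ → σ'} {r : σ' → σ}

/-- A statement as part of a larger machine: the stacks, labels and states are embedded by `ι`,
`lab` and `i`, the latter with retraction `r`, and `halt` becomes a jump to `exit`. -/
def embed (ι : K → K') (Γ : K' → Type) (lab : Λ → Λ') (exit : Λ') (i : σ → σ') (r : σ' → σ) :
    Stmt (fun k => Γ (ι k)) Λ σ → Stmt Γ Λ' σ'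
  | push k f q => push (ι k) (fun s => f (r s)) (embed ι Γ lab exit i r q)
  | peek k f q => peek (ι k) (fun s x => i (f (r s) x)) (embed ι Γ lab exit i r q)
  | pop k f q => pop (ι k) (fun s x => i (f (r s) x)) (embed ι Γ lab exit i r q)
  | load f q => load (fun s => i (f (r s))) (embed ι Γ lab exit i r q)
  | branch f q₁ q₂ =>
      branch (fun s => f (r s)) (embed ι Γ lab exit i r q₁) (embed ι Γ lab exit i r q₂)
  | goto f => goto fun s => lab (f (r s))
  | halt => goto fun _ => exit

/-- The configuration of the larger machine that corresponds to one of the embedded machine, where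
`lift` adds the contents of the other stacks. -/
def embedCfg (lab : Λ → Λ') (exit : Λ') (i : σ → σ')
    (lift : (∀ k, List (Γ (ι k))) → ∀ k, List (Γ k)) (c : Cfg (fun k => Γ (ι k)) Λ σ) :
    Cfg Γ Λ' σ' :=
  ⟨some (c.l.elim exit lab), i c.var, lift c.stk⟩

variable {lift : (∀ k, List (Γ (ι k))) → ∀ k, List (Γ k)}

theorem stepAux_embed (hr : LeftInverse r i) (hlift : ∀ S k, lift S (ι k) = S k)
    (hupdate : ∀ S k x, update (lift S) (ι k) x = lift (update S k x))
    (q : Stmt (fun k => Γ (ι k)) Λ σ) (v : σ) (S : ∀ k, List (Γ (ι k))) :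
    stepAux (embed ι Γ lab exit i r q) (i v) (lift S) =
      embedCfg lab exit i lift (stepAux q v S) := by
  induction q generalizing v S with
  | push k f q ih => simp only [embed, stepAux, hr v, hlift, hupdate, ih]
  | peek k f q ih => simp only [embed, stepAux, hr v, hlift, ih]
  | pop k f q ih => simp only [embed, stepAux, hr v, hlift, hupdate, ih]
  | load f q ih => simp only [embed, stepAux, hr v, ih]
  | branch f q₁ q₂ ih₁ ih₂ =>
    simp only [embed, stepAux, hr v]
    cases f v
    · exact ih₂ v S
    · exact ih₁ v S
  | goto f => simp only [embed, stepAux, hr v, embedCfg, Option.elim]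
  | halt => rfl

theorem Steps.embed (hr : LeftInverse r i) (hlift : ∀ S k, lift S (ι k) = S k)
    (hupdate : ∀ S k x, update (lift S) (ι k) x = lift (update S k x))
    {M : Λ → Stmt (fun k => Γ (ι k)) Λ σ} {M' : Λ' → Stmt Γ Λ' σ'}
    (hM : ∀ l, M' (lab l) = embed ι Γ lab exit i r (M l)) {n : ℕ}
    {c d : Cfg (fun k => Γ (ι k)) Λ σ} (h : Steps M n c d) :
    Steps M' n (embedCfg lab exit i lift c) (embedCfg lab exit i lift d) := by
  induction n generalizing d with
  | zero => obtain rfl := Option.some.inj h; rfl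
  | succ n ih =>
    obtain ⟨⟨l, v, S⟩, hcd, hd⟩ := steps_succ_iff.1 h
    obtain ⟨l, rfl, rfl⟩ := exists_eq_of_mem_step hd
    refine steps_succ_iff.2 ⟨_, ih hcd, congrArg some ?_⟩
    change stepAux (M' (lab l)) (i v) (lift S) = _
    rw [hM, stepAux_embed hr hlift hupdate]

end Embed

/-! ## Strings computable in polynomial time -/

/-- Stack contents that are empty except for `s` on the stack `k`. -/
def singleStack {K : Type} [DecidableEq K] {Γ : K → Type} (k : K) (s : List (Γ k)) :
    ∀ k, List (Γ k) :=
  update (fun _ => []) k s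

section SingleStack

variable {K : Type} [DecidableEq K] {Γ : K → Type} (k : K) (s t : List (Γ k))

@[simp]
theorem singleStack_self : singleStack k s k = s :=
  update_self _ _ _

@[simp]
theorem update_singleStack : update (singleStack k s) k t = singleStack k t :=
  update_idem _ _ _

@[simp]
theorem singleStack_nil : singleStack k ([] : List (Γ k)) = fun _ => [] :=
  update_eq_self _ _

theorem length_singleStack_le (j : K) : (singleStack k s j).length ≤ s.length := by
  rcases eq_or_ne j k with rfl | h
  · rw [singleStack_self]
  · simp [singleStack, h]

end SingleStack

theorem initList_eq (tm : FinTM2) (s : List (tm.Γ tm.k₀)) :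
    initList tm s = ⟨some tm.main, tm.initialState, singleStack tm.k₀ s⟩ := by
  refine congrArg (TM2.Cfg.mk _ _) (funext fun k => ?_)
  rcases eq_or_ne k tm.k₀ with rfl | h
  · simp
  · simp [singleStack, h]

theorem haltList_eq (tm : FinTM2) (s : List (tm.Γ tm.k₁)) :
    haltList tm s = ⟨none, tm.initialState, singleStack tm.k₁ s⟩ := by
  refine congrArg (TM2.Cfg.mk _ _) (funext fun k => ?_)
  rcases eq_or_ne k tm.k₁ with rfl | h
  · simp
  · simp [singleStack, h]

/-- A family of bit strings that is computed in polynomial time from `1ⁿ`, in the sense of the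
definition of `IsQPT`. -/
def PolyTime (f : ℕ → List Bool) : Prop :=
  Nonempty (TM2ComputableInPolyTime Computability.unaryEncodeNat (fun l : List Bool => l) f)

theorem unaryEncodeNat_eq_replicate (n : ℕ) :
    Computability.unaryEncodeNat n = List.replicate n true := by
  induction n with
  | zero => rfl
  | succ n ih => rw [Computability.unaryEncodeNat, ih, List.replicate_succ]

theorem polyTime_iff {f : ℕ → List Bool} :
    PolyTime f ↔ ∃ (tm : FinTM2) (ein : tm.Γ tm.k₀ ≃ Bool) (eout : tm.Γ tm.k₁ ≃ Bool)
      (t : ℕ → ℕ), PolyBounded t ∧ ∀ n, Steps tm.m (t n)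
        ⟨some tm.main, tm.initialState, singleStack tm.k₀ (.replicate n (ein.symm true))⟩
        ⟨none, tm.initialState, singleStack tm.k₁ ((f n).map eout.symm)⟩ := by
  simp only [← initList_eq, ← haltList_eq]
  constructor
  · rintro ⟨⟨⟨tm, ein, eout⟩, p, hrun⟩⟩
    refine ⟨tm, ein, eout, fun n => (hrun n).steps, ⟨p, fun n => ?_⟩, fun n => ?_⟩
    · simpa only [unaryEncodeNat_eq_replicate, List.length_replicate] using (hrun n).steps_le_m
    · rw [← List.map_replicate, ← unaryEncodeNat_eq_replicate]
      exact (hrun n).evals_in_steps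
  · rintro ⟨tm, ein, eout, t, ⟨p, hp⟩, hrun⟩
    refine ⟨⟨⟨tm, ein, eout⟩, p, fun n => ?_⟩⟩
    simp only [unaryEncodeNat_eq_replicate, List.map_replicate, List.length_replicate]
    exact ⟨⟨t n, hrun n⟩, hp n⟩

theorem PolyTime.polyBounded_length {f : ℕ → List Bool} (hf : PolyTime f) :
    PolyBounded fun n => (f n).length := by
  obtain ⟨tm, ein, eout, t, ht, hrun⟩ := polyTime_iff.1 hf
  have := tm.ΛFin
  obtain ⟨N, hN⟩ := Finite.exists_le fun l => pushes (tm.m l)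
  refine (PolyBounded.id.add (ht.mul (.const N))).mono fun n => ?_
  have hstart := length_singleStack_le tm.k₀ (List.replicate n (ein.symm true)) tm.k₁
  have hend := (hrun n).length_le hN tm.k₁
  simp only [singleStack_self, List.length_map, List.length_replicate] at hstart hend
  omega

/-- A one-stack program that erases its input and writes `l`. -/
def constProgram (l : List Bool) : Unit → Stmt (fun _ : Unit => Bool) Unit Bool := fun _ =>
  pop () (fun _ x => x.isSome) <| branch id (goto fun _ => ()) <|
    l.foldl (fun q b => push () (fun _ => b) q) halt

theorem stepAux_foldl_push {K Λ σ : Type} {Γ : K → Type} [DecidableEq K] (k : K)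
    (l s : List (Γ k)) (q : Stmt Γ Λ σ) (v : σ) :
    stepAux (l.foldl (fun q b => push k (fun _ => b) q) q) v (singleStack k s) =
      stepAux q v (singleStack k (l ++ s)) := by
  induction l generalizing q with
  | nil => rfl
  | cons b l ih => simp [ih, stepAux]

theorem steps_constProgram (l : List Bool) (n : ℕ) (v : Bool) :
    Steps (constProgram l) (n + 1) ⟨some (), v, singleStack () (List.replicate n true)⟩
      ⟨none, false, singleStack () l⟩ := by
  induction n generalizing v with
  | zero =>
    refine congrArg some ?_
    simp only [constProgram, stepAux, List.replicate_zero, singleStack_self, update_singleStack,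
      List.head?_nil, List.tail_nil, Option.isSome_none, id, cond_false, stepAux_foldl_push,
      List.append_nil]
  | succ n ih =>
    refine .head ?_
    simpa only [constProgram, stepAux, List.replicate_succ, singleStack_self, update_singleStack,
      List.head?_cons, List.tail_cons, Option.isSome_some, id, cond_true] using ih true

theorem PolyTime.const (l : List Bool) : PolyTime fun _ => l := by
  let tm : FinTM2 :=
    { K := Unit, k₀ := (), k₁ := (), Γ := fun _ => Bool, Λ := Unit, main := (), σ := Bool,
      initialState := false, m := constProgram l }
  refine polyTime_iff.2 ⟨tm, .refl Bool, .refl Bool, fun n => n + 1,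
    PolyBounded.id.add (.const 1), fun n => ?_⟩
  rw [Equiv.refl_symm, Equiv.coe_refl, List.map_id]
  exact steps_constProgram l n false

/-! ## Concatenation -/

section Append

/-- The stacks of a machine that runs two machines one after the other, and a spare one. -/
inductive AppendStack (K₁ K₂ : Type) : Type
  | spare
  | first (k : K₁)
  | second (k : K₂)
  deriving DecidableEq, Fintype

/-- The labels of a machine that runs two machines one after the other: it distributes the input
to both of them with `copy`, and it moves the output of the first one via the spare stack to that
of the second one with `unload` and `reload`. -/
inductive AppendLabel (Λ₁ Λ₂ : Type) : Type
  | copy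
  | first (l : Λ₁)
  | second (l : Λ₂)
  | unload
  | reload
  deriving Fintype

variable (tm₁ tm₂ : FinTM2) (in₁ : tm₁.Γ tm₁.k₀ ≃ Bool) (in₂ : tm₂.Γ tm₂.k₀ ≃ Bool)
  (out₁ : tm₁.Γ tm₁.k₁ ≃ Bool) (out₂ : tm₂.Γ tm₂.k₁ ≃ Bool)

/-- The stack alphabets of the combined machine; the spare stack holds bits. -/
@[reducible] def appendΓ : AppendStack tm₁.K tm₂.K → Type
  | .spare => Bool
  | .first k => tm₁.Γ k
  | .second k => tm₂.Γ k

/-- The internal states of the combined machine. The last component is a register for the bit that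
is being moved. -/
abbrev appendσ : Type := tm₁.σ × tm₂.σ × Option Bool

/-- The statements of the combined machine. -/
abbrev AppendStmt : Type :=
  Stmt (appendΓ tm₁ tm₂) (AppendLabel tm₁.Λ tm₂.Λ) (appendσ tm₁ tm₂)

variable {tm₁ tm₂} in
/-- The stack contents of the combined machine, assembled from those of the spare stack and of the
two machines. -/
def sideBySide (a : List Bool) (S₁ : ∀ k, List (tm₁.Γ k)) (S₂ : ∀ k, List (tm₂.Γ k)) :
    ∀ k, List (appendΓ tm₁ tm₂ k)
  | .spare => a
  | .first k => S₁ k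
  | .second k => S₂ k

/-- Move one letter of the input from the spare stack to the input stacks of both machines. -/
def copyStmt : AppendStmt tm₁ tm₂ :=
  pop .spare (fun v x => (v.1, v.2.1, x)) <| branch (fun v => v.2.2.isSome)
    (push (.first tm₁.k₀) (fun _ => in₁.symm true) <|
      push (.second tm₂.k₀) (fun _ => in₂.symm true) <| goto fun _ => .copy)
    (goto fun _ => .first tm₁.main)

/-- Move one letter of the output of the first machine to the spare stack. -/
def unloadStmt : AppendStmt tm₁ tm₂ :=
  pop (.first tm₁.k₁) (fun v x => (v.1, v.2.1, x.map out₁)) <| branch (fun v => v.2.2.isSome)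
    (push .spare (fun v => v.2.2.getD false) <| goto fun _ => .unload)
    (goto fun _ => .reload)

/-- Move one letter from the spare stack to the output of the second machine. Unloading has
reversed the output of the first machine, so reloading restores its order. -/
def reloadStmt : AppendStmt tm₁ tm₂ :=
  pop .spare (fun v x => (v.1, v.2.1, x)) <| branch (fun v => v.2.2.isSome)
    (push (.second tm₂.k₁) (fun v => out₂.symm (v.2.2.getD false)) <| goto fun _ => .reload)
    halt

/-- The program that runs two machines on the same input and concatenates their outputs. -/
def appendProgram : AppendLabel tm₁.Λ tm₂.Λ → AppendStmt tm₁ tm₂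
  | .copy => copyStmt tm₁ tm₂ in₁ in₂
  | .first l => embed .first (appendΓ tm₁ tm₂) .first (.second tm₂.main)
      (fun v => (v, tm₂.initialState, none)) Prod.fst (tm₁.m l)
  | .second l => embed .second (appendΓ tm₁ tm₂) .second .unload
      (fun v => (tm₁.initialState, v, none)) (fun v => v.2.1) (tm₂.m l)
  | .unload => unloadStmt tm₁ tm₂ out₁
  | .reload => reloadStmt tm₁ tm₂ out₂

/-- The machine that runs `appendProgram`. -/
def appendMachine : FinTM2 where
  K := AppendStack tm₁.K tm₂.K
  kFin := letI := tm₁.kFin; letI := tm₂.kFin; inferInstance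
  k₀ := .spare
  k₁ := .second tm₂.k₁
  Γ := appendΓ tm₁ tm₂
  Λ := AppendLabel tm₁.Λ tm₂.Λ
  main := .copy
  ΛFin := letI := tm₁.ΛFin; letI := tm₂.ΛFin; inferInstance
  σ := appendσ tm₁ tm₂
  initialState := (tm₁.initialState, tm₂.initialState, none)
  σFin := letI := tm₁.σFin; letI := tm₂.σFin; inferInstance
  Γk₀Fin := inferInstanceAs (Fintype Bool)
  m := appendProgram tm₁ tm₂ in₁ in₂ out₁ out₂

variable {tm₁ tm₂} (a b : List Bool) (S₁ : ∀ k, List (tm₁.Γ k)) (S₂ : ∀ k, List (tm₂.Γ k))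

@[simp]
theorem sideBySide_spare : sideBySide a S₁ S₂ .spare = a :=
  rfl

@[simp]
theorem sideBySide_first (k : tm₁.K) : sideBySide a S₁ S₂ (.first k) = S₁ k :=
  rfl

@[simp]
theorem sideBySide_second (k : tm₂.K) : sideBySide a S₁ S₂ (.second k) = S₂ k :=
  rfl

@[simp]
theorem update_sideBySide_spare :
    update (sideBySide a S₁ S₂) .spare b = sideBySide b S₁ S₂ := by
  funext k
  cases k <;> simp [sideBySide]

@[simp]
theorem update_sideBySide_first (k : tm₁.K) (x : List (tm₁.Γ k)) :
    update (sideBySide a S₁ S₂) (.first k) x = sideBySide a (update S₁ k x) S₂ := by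
  funext j
  cases j with
  | first j =>
    rcases eq_or_ne j k with rfl | h
    · simp [sideBySide]
    · simp [sideBySide, h]
  | _ => simp [sideBySide]

@[simp]
theorem update_sideBySide_second (k : tm₂.K) (x : List (tm₂.Γ k)) :
    update (sideBySide a S₁ S₂) (.second k) x = sideBySide a S₁ (update S₂ k x) := by
  funext j
  cases j with
  | second j =>
    rcases eq_or_ne j k with rfl | h
    · simp [sideBySide]
    · simp [sideBySide, h]
  | _ => simp [sideBySide]

theorem singleStack_spare :
    singleStack (Γ := appendΓ tm₁ tm₂) .spare a = sideBySide a (fun _ => []) fun _ => [] := by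
  funext k
  cases k <;> simp [singleStack, sideBySide]

theorem singleStack_second (k : tm₂.K) (x : List (tm₂.Γ k)) :
    singleStack (Γ := appendΓ tm₁ tm₂) (.second k) x =
      sideBySide [] (fun _ => []) (singleStack k x) := by
  rw [singleStack, singleStack, ← update_sideBySide_second, ← singleStack_spare,
    singleStack_nil]

theorem steps_copy (n j : ℕ) (x : Option Bool) :
    Steps (appendProgram tm₁ tm₂ in₁ in₂ out₁ out₂) (n + 1)
      ⟨some .copy, (tm₁.initialState, tm₂.initialState, x), sideBySide (.replicate n true)
        (singleStack tm₁.k₀ (.replicate j (in₁.symm true)))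
        (singleStack tm₂.k₀ (.replicate j (in₂.symm true)))⟩
      ⟨some (.first tm₁.main), (tm₁.initialState, tm₂.initialState, none), sideBySide []
        (singleStack tm₁.k₀ (.replicate (n + j) (in₁.symm true)))
        (singleStack tm₂.k₀ (.replicate (n + j) (in₂.symm true)))⟩ := by
  induction n generalizing j x with
  | zero =>
    refine congrArg some ?_
    simp [appendProgram, copyStmt, stepAux]
  | succ n ih =>
    refine .head ?_
    rw [Nat.add_right_comm n 1 j, Nat.add_assoc n j 1]
    simpa [appendProgram, copyStmt, stepAux, List.replicate_succ] using ih (j + 1) (some true)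

theorem steps_unload (l a : List Bool) (v₁ : tm₁.σ) (v₂ : tm₂.σ) (x : Option Bool) :
    Steps (appendProgram tm₁ tm₂ in₁ in₂ out₁ out₂) (l.length + 1)
      ⟨some .unload, (v₁, v₂, x), sideBySide a (singleStack tm₁.k₁ (l.map out₁.symm)) S₂⟩
      ⟨some .reload, (v₁, v₂, none), sideBySide (l.reverse ++ a) (fun _ => []) S₂⟩ := by
  induction l generalizing a x with
  | nil =>
    refine congrArg some ?_
    simp [appendProgram, unloadStmt, stepAux]
  | cons b l ih =>
    refine .head ?_
    simpa [appendProgram, unloadStmt, stepAux] using ih (b :: a) (some b)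

theorem steps_reload (l b : List Bool) (v₁ : tm₁.σ) (v₂ : tm₂.σ) (x : Option Bool) :
    Steps (appendProgram tm₁ tm₂ in₁ in₂ out₁ out₂) (l.length + 1)
      ⟨some .reload, (v₁, v₂, x), sideBySide l S₁ (singleStack tm₂.k₁ (b.map out₂.symm))⟩
      ⟨none, (v₁, v₂, none),
        sideBySide [] S₁ (singleStack tm₂.k₁ ((l.reverse ++ b).map out₂.symm))⟩ := by
  induction l generalizing b x with
  | nil =>
    refine congrArg some ?_
    simp [appendProgram, reloadStmt, stepAux]
  | cons c l ih =>
    refine .head ?_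
    simpa [appendProgram, reloadStmt, stepAux] using ih (c :: b) (some c)

theorem steps_append {n m₁ m₂ : ℕ} {x y : List Bool}
    (h₁ : Steps tm₁.m m₁
      ⟨some tm₁.main, tm₁.initialState, singleStack tm₁.k₀ (.replicate n (in₁.symm true))⟩
      ⟨none, tm₁.initialState, singleStack tm₁.k₁ (x.map out₁.symm)⟩)
    (h₂ : Steps tm₂.m m₂
      ⟨some tm₂.main, tm₂.initialState, singleStack tm₂.k₀ (.replicate n (in₂.symm true))⟩
      ⟨none, tm₂.initialState, singleStack tm₂.k₁ (y.map out₂.symm)⟩) :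
    Steps (appendProgram tm₁ tm₂ in₁ in₂ out₁ out₂)
      (n + 1 + (m₁ + (m₂ + (x.length + 1 + (x.length + 1)))))
      ⟨some .copy, (tm₁.initialState, tm₂.initialState, none),
        singleStack .spare (.replicate n true)⟩
      ⟨none, (tm₁.initialState, tm₂.initialState, none),
        singleStack (.second tm₂.k₁) ((x ++ y).map out₂.symm)⟩ := by
  have hcopy := steps_copy in₁ in₂ out₁ out₂ n 0 none
  have hfirst := h₁.embed (M' := appendProgram tm₁ tm₂ in₁ in₂ out₁ out₂)
    (Γ := appendΓ tm₁ tm₂) (ι := .first) (lab := .first) (exit := .second tm₂.main)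
    (i := fun v => (v, tm₂.initialState, none)) (r := Prod.fst)
    (lift := fun S => sideBySide [] S (singleStack tm₂.k₀ (.replicate n (in₂.symm true))))
    (fun _ => rfl) (fun _ _ => rfl) (fun _ _ _ => update_sideBySide_first ..) fun _ => rfl
  have hsecond := h₂.embed (M' := appendProgram tm₁ tm₂ in₁ in₂ out₁ out₂)
    (Γ := appendΓ tm₁ tm₂) (ι := .second) (lab := .second) (exit := .unload)
    (i := fun v => (tm₁.initialState, v, none)) (r := fun v => v.2.1)
    (lift := sideBySide [] (singleStack tm₁.k₁ (x.map out₁.symm)))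
    (fun _ => rfl) (fun _ _ => rfl) (fun _ _ _ => update_sideBySide_second ..) fun _ => rfl
  have hunload := steps_unload in₁ in₂ out₁ out₂ (singleStack tm₂.k₁ (y.map out₂.symm)) x []
    tm₁.initialState tm₂.initialState none
  have hreload := steps_reload in₁ in₂ out₁ out₂ (fun _ => []) x.reverse y
    tm₁.initialState tm₂.initialState none
  rw [List.replicate_zero, List.replicate_zero, singleStack_nil, singleStack_nil,
    ← singleStack_spare] at hcopy
  rw [List.append_nil] at hunload
  rw [List.length_reverse, List.reverse_reverse, ← singleStack_second] at hreload
  exact hcopy.trans (hfirst.trans (hsecond.trans (hunload.trans hreload)))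

end Append

theorem PolyTime.append {f g : ℕ → List Bool} (hf : PolyTime f) (hg : PolyTime g) :
    PolyTime fun n => f n ++ g n := by
  have hlength := hf.polyBounded_length.add (.const 1)
  obtain ⟨tm₁, in₁, out₁, t₁, ht₁, hrun₁⟩ := polyTime_iff.1 hf
  obtain ⟨tm₂, in₂, out₂, t₂, ht₂, hrun₂⟩ := polyTime_iff.1 hg
  exact polyTime_iff.2 ⟨appendMachine tm₁ tm₂ in₁ in₂ out₁ out₂, .refl Bool, out₂, _,
    (PolyBounded.id.add (.const 1)).add (ht₁.add (ht₂.add (hlength.add hlength))),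
    fun n => steps_append in₁ in₂ out₁ out₂ (hrun₁ n) (hrun₂ n)⟩

end StackMachines

/-! ## Efficient families of circuits -/

theorem Circ.width_le {G : Wires → Wires → Type} {cost : ∀ a b, G a b → ℕ}
    (hcost : ∀ a b (g : G a b), b.width ≤ a.width + cost a b g) {a b : Wires} (C : Circ G a b) :
    b.width ≤ a.width + C.sizeWith cost := by
  induction C with
  | gate g => exact hcost _ _ g
  | _ => simp only [Circ.sizeWith, Wires.width]; omega

theorem BGate.width_le (a b : Wires) (g : BGate a b) : b.width ≤ a.width + g.cost := by
  cases g <;> simp only [BGate.cost, Wires.width] <;> omega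

theorem QGate.width_le (a b : Wires) (g : QGate a b) : b.width ≤ a.width + g.cost := by
  cases g with
  | classical c => exact (c.width_le BGate.width_le).trans (by simp only [QGate.cost]; omega)
  | _ => simp only [QGate.cost, Wires.width]; omega

/-- A family of circuits of polynomial size with descriptions computable in polynomial time. Unlike
in `IsQPT`, the input register is not required to have polynomial width, so that all rewirings
qualify. -/
structure Efficient {a b : ℕ → Wires} (C : ∀ n, QCirc (a n) (b n)) : Prop where
  size : PolyBounded fun n => (C n).size
  polyTime : PolyTime fun n => (C n).code

/-- Measure a register and copy the outcome. -/
def dup (a : Wires) : QCirc a (a ⊠ a) := .gate (.classical (.gate (.dup a)))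

/-- Exchange the first two of three registers. -/
def exch (a b c : Wires) : QCirc (a ⊠ b ⊠ c) (b ⊠ a ⊠ c) :=
  .seq (.assocInv a b c) (.seq (.par (.swap a b) (.id c)) (.assoc b a c))

section Efficient

variable {a b c d : ℕ → Wires}

theorem IsQPT.polyBounded_width_input {C : ∀ n, QCirc (a n) (b n)} (h : IsQPT C) :
    PolyBounded fun n => (a n).width :=
  PolyBounded.mono h.1 fun _ => Nat.le_add_right _ _

theorem IsQPT.polyBounded_width_output {C : ∀ n, QCirc (a n) (b n)} (h : IsQPT C) :
    PolyBounded fun n => (b n).width :=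
  PolyBounded.mono h.1 fun n => (C n).width_le QGate.width_le

theorem IsQPT.efficient {C : ∀ n, QCirc (a n) (b n)} (h : IsQPT C) : Efficient C :=
  ⟨PolyBounded.mono h.1 fun _ => Nat.le_add_left _ _, h.2⟩

theorem Efficient.isQPT {C : ∀ n, QCirc (a n) (b n)} (h : Efficient C)
    (ha : PolyBounded fun n => (a n).width) : IsQPT C :=
  ⟨ha.add h.size, h.polyTime⟩

theorem Efficient.seq {C : ∀ n, QCirc (a n) (b n)} {D : ∀ n, QCirc (b n) (c n)}
    (hC : Efficient C) (hD : Efficient D) : Efficient fun n => .seq (C n) (D n) :=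
  ⟨hC.size.add hD.size, (PolyTime.const _).append (hC.polyTime.append hD.polyTime)⟩

theorem Efficient.par {C : ∀ n, QCirc (a n) (b n)} {D : ∀ n, QCirc (c n) (d n)}
    (hC : Efficient C) (hD : Efficient D) : Efficient fun n => .par (C n) (D n) :=
  ⟨hC.size.add hD.size, (PolyTime.const _).append (hC.polyTime.append hD.polyTime)⟩

theorem Efficient.id : Efficient fun n => (.id (a n) : QCirc _ _) :=
  ⟨.const 0, .const _⟩

theorem Efficient.swap : Efficient fun n => (.swap (a n) (b n) : QCirc _ _) :=
  ⟨.const 0, .const _⟩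

theorem Efficient.assoc : Efficient fun n => (.assoc (a n) (b n) (c n) : QCirc _ _) :=
  ⟨.const 0, .const _⟩

theorem Efficient.assocInv : Efficient fun n => (.assocInv (a n) (b n) (c n) : QCirc _ _) :=
  ⟨.const 0, .const _⟩

theorem Efficient.unitLInv : Efficient fun n => (.unitLInv (a n) : QCirc _ _) :=
  ⟨.const 0, .const _⟩

theorem Efficient.dup (ha : PolyBounded fun n => (a n).width) :
    Efficient fun n => QCrypto.dup (a n) :=
  ⟨ha.add ha, .const (QCrypto.dup .unit).code⟩

theorem Efficient.exch : Efficient fun n => QCrypto.exch (a n) (b n) (c n) :=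
  assocInv.seq ((swap.par id).seq assoc)

end Efficient

/-! ## Completely positive maps -/

open Matrix
open scoped ComplexOrder

/-- Complete positivity, in the form of the existence of a Kraus decomposition. -/
def IsCP {α β : Type} [Fintype α] (Φ : Matrix α α ℂ → Matrix β β ℂ) : Prop :=
  ∃ (ι : Type) (_ : Fintype ι) (K : ι → Matrix β α ℂ), ∀ ρ, Φ ρ = ∑ i, K i * ρ * (K i)ᴴ

section CP

variable {α β γ κ : Type} [Fintype α] {Φ : Matrix α α ℂ → Matrix β β ℂ}

theorem IsCP.conj (K : Matrix β α ℂ) : IsCP fun ρ : Matrix α α ℂ => K * ρ * Kᴴ :=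
  ⟨Unit, inferInstance, fun _ => K, fun ρ => by rw [Fintype.sum_unique]⟩

theorem IsCP.submatrix (e : β → α) : IsCP fun ρ : Matrix α α ℂ => ρ.submatrix e e := by
  classical
  convert IsCP.conj ((1 : Matrix α α ℂ).submatrix e id) using 2 with ρ
  ext i j
  simp [Matrix.mul_apply, Matrix.one_apply]

theorem IsCP.comp [Fintype β] {Ψ : Matrix β β ℂ → Matrix γ γ ℂ} (hΨ : IsCP Ψ) (hΦ : IsCP Φ) :
    IsCP fun ρ => Ψ (Φ ρ) := by
  obtain ⟨ι, _, K, hK⟩ := hΦ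
  obtain ⟨ι', _, K', hK'⟩ := hΨ
  refine ⟨ι' × ι, inferInstance, fun i => K' i.1 * K i.2, fun ρ => ?_⟩
  simp only [hK, hK', Fintype.sum_prod_type, Matrix.conjTranspose_mul, Matrix.mul_assoc,
    Matrix.mul_sum, Matrix.sum_mul]

theorem IsCP.isLinearMap (hΦ : IsCP Φ) : IsLinearMap ℂ Φ := by
  obtain ⟨ι, _, K, hK⟩ := hΦ
  refine ⟨fun ρ σ => ?_, fun c ρ => ?_⟩
  · simp only [hK, Matrix.mul_add, Matrix.add_mul, Finset.sum_add_distrib]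
  · simp only [hK, Matrix.mul_smul, Matrix.smul_mul, Finset.smul_sum]

theorem IsCP.map_smul (hΦ : IsCP Φ) (c : ℂ) (ρ : Matrix α α ℂ) : Φ (c • ρ) = c • Φ ρ :=
  hΦ.isLinearMap.map_smul c ρ

theorem IsCP.map_sum (hΦ : IsCP Φ) {ι : Type*} (s : Finset ι) (f : ι → Matrix α α ℂ) :
    Φ (∑ i ∈ s, f i) = ∑ i ∈ s, Φ (f i) :=
  _root_.map_sum (hΦ.isLinearMap.mk' Φ) f s

theorem IsCP.posSemidef [Finite β] (hΦ : IsCP Φ) {ρ : Matrix α α ℂ} (hρ : ρ.PosSemidef) :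
    (Φ ρ).PosSemidef := by
  obtain ⟨ι, _, K, hK⟩ := hΦ
  rw [hK]
  exact Matrix.posSemidef_sum _ fun i _ => hρ.mul_mul_conjTranspose_same (K i)

theorem IsCP.onLeft [Fintype κ] (hΦ : IsCP Φ) :
    IsCP (onLeft Φ : Matrix (α × κ) (α × κ) ℂ → Matrix (β × κ) (β × κ) ℂ) := by
  classical
  obtain ⟨ι, _, K, hK⟩ := hΦ
  refine ⟨ι, inferInstance, fun i => K i ⊗ₖ (1 : Matrix κ κ ℂ), fun ρ => ?_⟩
  ext ⟨p, k⟩ ⟨q, l⟩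
  simp only [QCrypto.onLeft, hK, Matrix.of_apply, Matrix.sum_apply]
  refine Finset.sum_congr rfl fun i _ => ?_
  simp [Matrix.mul_apply, Fintype.sum_prod_type, Matrix.one_apply, apply_ite]

theorem IsCP.onRight [Finite β] [Fintype κ] (hΦ : IsCP Φ) :
    IsCP (onRight Φ : Matrix (κ × α) (κ × α) ℂ → Matrix (κ × β) (κ × β) ℂ) :=
  have := Fintype.ofFinite β
  (IsCP.submatrix Prod.swap).comp ((hΦ.onLeft (κ := κ)).comp (IsCP.submatrix Prod.swap))

theorem IsCP.onLeft_kronecker (hΦ : IsCP Φ) (A : Matrix α α ℂ) (B : Matrix κ κ ℂ) :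
    QCrypto.onLeft Φ (A ⊗ₖ B) = Φ A ⊗ₖ B := by
  ext ⟨p, k⟩ ⟨q, l⟩
  have hblock : (Matrix.of fun i j => (A ⊗ₖ B) (i, k) (j, l)) = B k l • A := by
    ext i j
    exact mul_comm _ _
  simp only [QCrypto.onLeft, Matrix.of_apply, hblock, hΦ.map_smul]
  exact mul_comm _ _

theorem IsCP.onRight_kronecker (hΦ : IsCP Φ) (A : Matrix κ κ ℂ) (B : Matrix α α ℂ) :
    QCrypto.onRight Φ (A ⊗ₖ B) = A ⊗ₖ Φ B := by
  ext ⟨p, k⟩ ⟨q, l⟩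
  have hblock : (Matrix.of fun i j => (A ⊗ₖ B) (p, i) (q, j)) = A p q • B := rfl
  simp only [QCrypto.onRight, Matrix.of_apply, hblock, hΦ.map_smul]
  rfl

end CP

/-! ## The operations performed by circuits -/

theorem isCP_coin : IsCP (QGate.denote .coin) := by
  have hsqrt : ((√2 : ℝ) : ℂ)⁻¹ * ((√2 : ℝ) : ℂ)⁻¹ = 2⁻¹ := by
    rw [← mul_inv, ← Complex.ofReal_mul, Real.mul_self_sqrt zero_le_two, Complex.ofReal_ofNat]
  refine ⟨Bool, inferInstance, fun y => Matrix.single y () ((√2 : ℝ) : ℂ)⁻¹, fun ρ => ?_⟩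
  have hscale : ∀ z : ℂ, ((√2 : ℝ) : ℂ)⁻¹ * z * ((√2 : ℝ) : ℂ)⁻¹ = z / 2 := fun z => by
    rw [mul_right_comm, hsqrt, mul_comm, div_eq_mul_inv]
  change Matrix.diagonal _ = _
  ext i j
  cases i <;> cases j <;> simp [hscale]

theorem denote_classical {a b : Wires} (c : BCirc a b) (ρ : Op a) :
    QCirc.denote (.gate (.classical c)) ρ = ∑ x, ρ x x • ket (c.eval x) := by
  change Matrix.diagonal _ = _
  simp only [ket, Matrix.smul_single, smul_eq_mul, mul_one]
  ext i j
  simp only [Matrix.diagonal_apply, Matrix.sum_apply, Matrix.single_apply]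
  split_ifs with h
  · simp only [h, and_self]
  · exact (Finset.sum_eq_zero fun x _ => if_neg fun hx => h (hx.1.symm.trans hx.2)).symm

theorem isCP_classical {a b : Wires} (c : BCirc a b) : IsCP (QGate.denote (.classical c)) :=
  ⟨a.val, inferInstance, fun x => Matrix.single (c.eval x) x 1, fun ρ => by
    simp only [Matrix.conjTranspose_single, Matrix.single_mul_mul_single, star_one, one_mul,
      mul_one]
    refine (denote_classical c ρ).trans (Finset.sum_congr rfl fun x _ => ?_)
    rw [ket, Matrix.smul_single, smul_eq_mul, mul_one]⟩

theorem QGate.isCP : ∀ {a b : Wires} (g : QGate a b), IsCP g.denote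
  | _, _, .hadamard => .conj _
  | _, _, .phase => .conj _
  | _, _, .cnot => .submatrix _
  | _, _, .coin => isCP_coin
  | _, _, .classical c => isCP_classical c

theorem QCirc.isCP {a b : Wires} (C : QCirc a b) : IsCP C.denote := by
  induction C with
  | id a => exact IsCP.submatrix (fun x => x)
  | seq f g ihf ihg => exact ihg.comp ihf
  | par f g ihf ihg => exact ihg.onRight.comp ihf.onLeft
  | gate g => exact g.isCP
  | _ => exact IsCP.submatrix _

theorem denote_seq {a b c : Wires} (f : QCirc a b) (g : QCirc b c) (ρ : Op a) :
    QCirc.denote (.seq f g) ρ = g.denote (f.denote ρ) :=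
  rfl

theorem denote_id {a : Wires} (ρ : Op a) : QCirc.denote (.id a) ρ = ρ :=
  rfl

/-- The product operator `A ⊗ B` on a pair of registers: the Kronecker product, with its index type
kept in the form `(a ⊠ b).val`. -/
def Op.tensor {a b : Wires} (A : Op a) (B : Op b) : Op (a ⊠ b) := A ⊗ₖ B

infixr:75 " ⊗ₒ " => Op.tensor

section Tensor

variable {a b c d : Wires}

theorem Op.smul_tensor (z : ℂ) (A : Op a) (B : Op b) : (z • A) ⊗ₒ B = z • A ⊗ₒ B :=
  smul_kronecker z A B

theorem Op.tensor_smul (z : ℂ) (A : Op a) (B : Op b) : A ⊗ₒ (z • B) = z • A ⊗ₒ B :=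
  kronecker_smul z A B

theorem Op.sum_tensor {ι : Type*} (s : Finset ι) (A : ι → Op a) (B : Op b) :
    (∑ i ∈ s, A i) ⊗ₒ B = ∑ i ∈ s, A i ⊗ₒ B := by
  ext i j
  simp only [Op.tensor, kroneckerMap_apply, Matrix.sum_apply, Finset.sum_mul]

theorem Op.one_tensor_one : (1 : Op a) ⊗ₒ (1 : Op b) = 1 :=
  one_kronecker_one

theorem denote_par_tensor (f : QCirc a b) (g : QCirc c d) (A : Op a) (B : Op c) :
    QCirc.denote (.par f g) (A ⊗ₒ B) = f.denote A ⊗ₒ g.denote B :=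
  (congrArg _ (f.isCP.onLeft_kronecker A B)).trans (g.isCP.onRight_kronecker _ B)

theorem denote_swap_tensor (A : Op a) (B : Op b) :
    QCirc.denote (.swap a b) (A ⊗ₒ B) = B ⊗ₒ A := by
  ext i j
  exact mul_comm _ _

theorem denote_assoc_tensor (A : Op a) (B : Op b) (C : Op c) :
    QCirc.denote (.assoc a b c) ((A ⊗ₒ B) ⊗ₒ C) = A ⊗ₒ B ⊗ₒ C := by
  ext i j
  exact mul_assoc _ _ _

theorem denote_assocInv_tensor (A : Op a) (B : Op b) (C : Op c) :
    QCirc.denote (.assocInv a b c) (A ⊗ₒ B ⊗ₒ C) = (A ⊗ₒ B) ⊗ₒ C := by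
  ext i j
  exact (mul_assoc _ _ _).symm

theorem denote_exch_tensor (A : Op a) (B : Op b) (C : Op c) :
    QCirc.denote (exch a b c) (A ⊗ₒ B ⊗ₒ C) = B ⊗ₒ A ⊗ₒ C := by
  rw [exch, denote_seq, denote_assocInv_tensor, denote_seq, denote_par_tensor, denote_swap_tensor,
    denote_id, denote_assoc_tensor]

theorem denote_unitLInv (A : Op a) :
    QCirc.denote (.unitLInv a) A = ket (w := .unit) () ⊗ₒ A := by
  ext i j
  change A i.2 j.2 = Matrix.single () () 1 i.1 j.1 * A i.2 j.2
  rw [Matrix.single_apply_same, one_mul]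

end Tensor

/-! ## Sampling circuits -/

theorem ket_tensor_ket {a b : Wires} (x : a.val) (y : b.val) :
    ket x ⊗ₒ ket y = ket (w := a ⊠ b) (x, y) := by
  rw [ket, ket, Op.tensor, single_kronecker_single, one_mul]
  rfl

theorem posSemidef_ket {a : Wires} (x : a.val) : (ket x).PosSemidef := by
  have h := (PosSemidef.one (n := Unit) (R := ℂ)).mul_mul_conjTranspose_same (single x () 1)
  rwa [Matrix.mul_one, conjTranspose_single, star_one, single_mul_single_same, one_mul] at h

theorem sum_ket_smul {a b : Wires} (x : a.val) (A : a.val → Op b) :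
    ∑ y, ket x y y • A y = A x := by
  rw [Fintype.sum_eq_single x fun y hy => ?_]
  · rw [ket, single_apply_same, one_smul]
  · rw [ket, single_apply_of_ne _ _ _ _ _ fun hx => hy hx.1.symm, zero_smul]

theorem denote_classical_ket {a b : Wires} (c : BCirc a b) (x : a.val) :
    QCirc.denote (.gate (.classical c)) (ket x) = ket (c.eval x) :=
  (denote_classical c _).trans (sum_ket_smul x _)

theorem denote_dup_ket {a : Wires} (x : a.val) :
    QCirc.denote (dup a) (ket x) = ket x ⊗ₒ ket x :=
  (denote_classical_ket _ x).trans (ket_tensor_ket x x).symm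

theorem card_tensor (a b : Wires) :
    Fintype.card (a ⊠ b).val = Fintype.card a.val * Fintype.card b.val :=
  Fintype.card_prod _ _

theorem denote_coins (w : Wires) :
    (coins w).denote (ket ()) = (Fintype.card w.val : ℂ)⁻¹ • (1 : Op w) := by
  induction w with
  | unit =>
    ext i j
    simp [coins, QCirc.denote, ket]
  | bit =>
    change Matrix.diagonal _ = _
    rw [← Matrix.diagonal_one, ← Matrix.diagonal_smul]
    congr 1
    funext i
    simp [ket]
  | tensor a b iha ihb =>
    rw [coins, denote_seq, denote_unitLInv, denote_par_tensor, iha, ihb, Op.smul_tensor,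
      Op.tensor_smul, Op.one_tensor_one, smul_smul, card_tensor, Nat.cast_mul, mul_inv]

/-- The state of a register holding the output `f s` of an algorithm with uniform random input
`s`. -/
def outputState {r b : Wires} (f : r.val → b.val) : Op b :=
  (Fintype.card r.val : ℂ)⁻¹ • ∑ s, ket (f s)

theorem denote_sample {a r b : Wires} (c : BCirc (a ⊠ r) b) (ρ : Op a) :
    (sample c).denote ρ = ∑ x, ρ x x • outputState fun s => c.eval (x, s) := by
  rw [sample, denote_seq, denote_seq, denote_seq, denote_unitLInv, denote_swap_tensor,
    denote_par_tensor, denote_coins, denote_id, Op.tensor_smul, (QCirc.isCP _).map_smul,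
    denote_classical]
  simp only [outputState, Finset.smul_sum]
  refine (Fintype.sum_prod_type _).trans
    (Fintype.sum_congr _ _ fun x => Fintype.sum_congr _ _ fun s => ?_)
  rw [smul_comm (ρ x x)]
  congr 2
  change ρ x x * (1 : Op r) s s = ρ x x
  rw [Matrix.one_apply_eq, mul_one]

theorem denote_sample_ket {a r b : Wires} (c : BCirc (a ⊠ r) b) (x : a.val) :
    (sample c).denote (ket x) = outputState fun s => c.eval (x, s) :=
  (denote_sample c _).trans (sum_ket_smul x _)

theorem denote_sample_par_id {a r b d : Wires} (c : BCirc (a ⊠ r) b) (ρ : Op (a ⊠ d)) :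
    QCirc.denote (.par (sample c) (.id d)) ρ =
      ∑ x, (outputState fun s => c.eval (x, s)) ⊗ₒ condOn ρ x := by
  ext i j
  change (sample c).denote (Matrix.of fun p q => ρ (p, i.2) (q, j.2)) i.1 j.1 = _
  rw [denote_sample, Matrix.sum_apply, Matrix.sum_apply]
  exact Fintype.sum_congr _ _ fun x => mul_comm _ _

/-! ## The circuit of the reduction -/

section Reduction

variable {fpk msk spk dk F st sk X D R r : Wires}

/-- Generate a pair of keys, and copy the public one so that it can be both used and output. -/
def generateKeys (setup : BCirc (.unit ⊠ r) (fpk ⊠ msk)) :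
    QCirc (spk ⊠ dk) (fpk ⊠ msk ⊠ (fpk ⊠ spk) ⊠ dk) :=
  .seq (.unitLInv (spk ⊠ dk)) <|
  .seq (.par (.seq (sample setup) (.par (dup fpk) (.id msk))) (.id (spk ⊠ dk))) <|
  .seq (.assoc (fpk ⊠ fpk) msk (spk ⊠ dk)) <|
  .seq (.assoc fpk fpk (msk ⊠ spk ⊠ dk)) <|
  .par (.id fpk) (.seq (exch fpk msk (spk ⊠ dk)) (.par (.id msk) (.assocInv fpk spk dk)))

/-- Measure the query `f` of a pirate and answer it with a functional key for `f`. -/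
def answerQuery (kg : BCirc ((msk ⊠ F) ⊠ r) sk) :
    QCirc (msk ⊠ (F ⊠ st) ⊠ dk) (st ⊠ sk ⊠ dk) :=
  .seq (.par (.id msk) (.assoc F st dk)) <|
  .seq (.assocInv msk F (st ⊠ dk)) <|
  .seq (.par (sample kg) (.id (st ⊠ dk))) (exch sk st dk)

/-- Append a key to the inputs `x₀`, `x₁` in the classical output of a pirate. -/
def appendKey (fpk X D R : Wires) : QCirc (fpk ⊠ (X ⊠ X ⊠ D) ⊠ R) ((X ⊠ X ⊠ fpk ⊠ D) ⊠ R) :=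
  .seq (.assocInv fpk (X ⊠ X ⊠ D) R) <|
  .par (.seq (exch fpk X (X ⊠ D)) (.par (.id X) (exch fpk X D))) (.id R)

/-- Run both stages of a pirate of the nested scheme on a given single-decryptor public key and
quantum key, with self-generated functional encryption keys, and output the functional encryption
public key together with the output of the pirate. -/
def reduction {r' : Wires} (setup : BCirc (.unit ⊠ r) (fpk ⊠ msk))
    (kg : BCirc ((msk ⊠ F) ⊠ r') sk) (query : QCirc (fpk ⊠ spk) (F ⊠ st))
    (run : QCirc (st ⊠ sk ⊠ dk) ((X ⊠ X ⊠ D) ⊠ R)) :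
    QCirc (spk ⊠ dk) ((X ⊠ X ⊠ fpk ⊠ D) ⊠ R) :=
  .seq (generateKeys setup) <|
  .seq (.par (.id fpk)
    (.seq (.par (.id msk) (.par query (.id dk))) (.seq (answerQuery kg) run))) <|
  appendKey fpk X D R

theorem denote_generateKeys (setup : BCirc (.unit ⊠ r) (fpk ⊠ msk)) (pk : spk.val) (σ : Op dk) :
    (generateKeys setup).denote (ket pk ⊗ₒ σ) =
      (Fintype.card r.val : ℂ)⁻¹ • ∑ s, ket (setup.eval ((), s)).1 ⊗ₒ
        ket (setup.eval ((), s)).2 ⊗ₒ ket (w := fpk ⊠ spk) ((setup.eval ((), s)).1, pk) ⊗ₒ σ := by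
  rw [generateKeys, denote_seq, denote_unitLInv, denote_seq, denote_par_tensor, denote_seq,
    denote_seq, denote_seq, denote_id, denote_sample_ket, outputState, (QCirc.isCP _).map_smul,
    (QCirc.isCP _).map_sum, Op.smul_tensor, Op.sum_tensor, (QCirc.isCP _).map_smul,
    (QCirc.isCP _).map_sum, (QCirc.isCP _).map_smul, (QCirc.isCP _).map_sum,
    (QCirc.isCP _).map_smul, (QCirc.isCP _).map_sum]
  refine congrArg (_ • ·) (Fintype.sum_congr _ _ fun s => ?_)
  obtain ⟨k, m⟩ := setup.eval ((), s)
  simp only [← ket_tensor_ket, denote_par_tensor, denote_dup_ket, denote_assoc_tensor, denote_seq,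
    denote_exch_tensor, denote_assocInv_tensor, denote_id]

theorem denote_answerQuery (kg : BCirc ((msk ⊠ F) ⊠ r) sk) (k : msk.val) (ρ : Op (F ⊠ st))
    (σ : Op dk) :
    (answerQuery kg).denote (ket k ⊗ₒ ρ ⊗ₒ σ) =
      ∑ f, condOn ρ f ⊗ₒ (outputState fun s => kg.eval ((k, f), s)) ⊗ₒ σ := by
  have hcond : ∀ x : (msk ⊠ F).val, condOn (QCirc.denote (.assocInv msk F (st ⊠ dk))
      (QCirc.denote (.par (.id msk) (.assoc F st dk)) (ket k ⊗ₒ ρ ⊗ₒ σ))) x =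
      ket k x.1 x.1 • condOn ρ x.2 ⊗ₒ σ := fun x => by
    rw [denote_par_tensor]
    ext i j
    exact congrArg _ rfl
  rw [answerQuery, denote_seq, denote_seq, denote_seq, denote_sample_par_id,
    (QCirc.isCP _).map_sum]
  refine (Fintype.sum_prod_type _).trans (Eq.trans ?_ (sum_ket_smul k fun k' =>
    ∑ f, condOn ρ f ⊗ₒ (outputState fun s => kg.eval ((k', f), s)) ⊗ₒ σ))
  refine Fintype.sum_congr _ _ fun k' => (Fintype.sum_congr _ _ fun f => ?_).trans
    Finset.smul_sum.symm
  rw [hcond, Op.tensor_smul, (QCirc.isCP _).map_smul, denote_exch_tensor]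

theorem denote_reduction {r' : Wires} (setup : BCirc (.unit ⊠ r) (fpk ⊠ msk))
    (kg : BCirc ((msk ⊠ F) ⊠ r') sk) (query : QCirc (fpk ⊠ spk) (F ⊠ st))
    (run : QCirc (st ⊠ sk ⊠ dk) ((X ⊠ X ⊠ D) ⊠ R)) (pk : spk.val) (σ : Op dk) :
    (reduction setup kg query run).denote (ket pk ⊗ₒ σ) =
      (Fintype.card r.val : ℂ)⁻¹ • ∑ s, (appendKey fpk X D R).denote
        (ket (setup.eval ((), s)).1 ⊗ₒ ∑ f, run.denote
          (condOn (query.denote (ket (w := fpk ⊠ spk) ((setup.eval ((), s)).1, pk))) f ⊗ₒ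
            (outputState fun s' => kg.eval (((setup.eval ((), s)).2, f), s')) ⊗ₒ σ)) := by
  simp only [reduction, denote_seq, denote_generateKeys, (QCirc.isCP _).map_smul,
    (QCirc.isCP _).map_sum, denote_par_tensor, denote_id, denote_answerQuery]

theorem condOn_denote_appendKey (k k' : fpk.val) (x₀ x₁ : X.val) (d : D.val)
    (ρ : Op ((X ⊠ X ⊠ D) ⊠ R)) :
    condOn (a := X ⊠ X ⊠ fpk ⊠ D) ((appendKey fpk X D R).denote (ket k ⊗ₒ ρ)) (x₀, x₁, k', d) =
      ket k k' k' • condOn (a := X ⊠ X ⊠ D) ρ (x₀, x₁, d) :=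
  rfl

end Reduction

section EfficientReduction

variable {fpk msk spk dk F st sk X D R r r' : ℕ → Wires}

theorem efficient_generateKeys {setup : ∀ n, BCirc (.unit ⊠ r n) (fpk n ⊠ msk n)}
    (hsetup : IsQPT fun n => sample (setup n)) :
    Efficient fun n => generateKeys (spk := spk n) (dk := dk n) (setup n) :=
  have hfpk : PolyBounded fun n => (fpk n).width :=
    hsetup.polyBounded_width_output.mono fun _ => Nat.le_add_right _ _
  Efficient.unitLInv.seq <|
  ((hsetup.efficient.seq ((Efficient.dup hfpk).par .id)).par .id).seq <|
  Efficient.assoc.seq <| Efficient.assoc.seq <|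
  Efficient.id.par (Efficient.exch.seq (Efficient.id.par .assocInv))

theorem efficient_answerQuery {kg : ∀ n, BCirc ((msk n ⊠ F n) ⊠ r n) (sk n)}
    (hkg : Efficient fun n => sample (kg n)) :
    Efficient fun n => answerQuery (st := st n) (dk := dk n) (kg n) :=
  (Efficient.id.par .assoc).seq <| Efficient.assocInv.seq <| (hkg.par .id).seq .exch

theorem efficient_appendKey : Efficient fun n => appendKey (fpk n) (X n) (D n) (R n) :=
  Efficient.assocInv.seq <| (Efficient.exch.seq (Efficient.id.par .exch)).par .id

theorem efficient_reduction {setup : ∀ n, BCirc (.unit ⊠ r n) (fpk n ⊠ msk n)}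
    {kg : ∀ n, BCirc ((msk n ⊠ F n) ⊠ r' n) (sk n)}
    {query : ∀ n, QCirc (fpk n ⊠ spk n) (F n ⊠ st n)}
    {run : ∀ n, QCirc (st n ⊠ sk n ⊠ dk n) ((X n ⊠ X n ⊠ D n) ⊠ R n)}
    (hsetup : IsQPT fun n => sample (setup n)) (hkg : Efficient fun n => sample (kg n))
    (hquery : Efficient query) (hrun : Efficient run) :
    Efficient fun n => reduction (setup n) (kg n) (query n) (run n) :=
  (efficient_generateKeys hsetup).seq <|
  (Efficient.id.par <| (Efficient.id.par (hquery.par .id)).seq <|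
    (efficient_answerQuery hkg).seq hrun).seq efficient_appendKey

end EfficientReduction

/-! ## Monotonicity of the tests -/

open scoped MatrixOrder

section Tests

variable {w : Wires}

theorem projImp_nonneg (P : Op w) (p : ℝ) : 0 ≤ projImp P p :=
  cfc_nonneg fun x _ => by split_ifs <;> norm_num

theorem thresholdImp_nonneg (t : ℝ) (P : Op w) : 0 ≤ thresholdImp t P :=
  Finset.sum_nonneg fun p _ => by
    split_ifs
    exacts [projImp_nonneg P p, le_rfl]

theorem thresholdImp_antitone (P : Op w) : Antitone fun t => thresholdImp t P :=
  fun t' t h => Finset.sum_le_sum fun p _ => by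
    by_cases hp : t ≤ p
    · rw [if_pos hp, if_pos (h.trans hp)]
    · rw [if_neg hp]
      split_ifs
      exacts [projImp_nonneg P p, le_rfl]

variable {Ω : Type} [Fintype Ω] {c : Wires} (R : Wires) (D : Ω → Bool × c.val) (s : List Bool)

theorem testProj_nonneg (γ : ℝ) : 0 ≤ testProj R γ D s := by
  rw [testProj]
  split
  exacts [thresholdImp_nonneg _ _, le_rfl]

theorem testProj_antitone : Antitone fun γ => testProj R γ D s := by
  intro γ' γ h
  simp only [testProj]
  split
  exacts [thresholdImp_antitone _ (add_le_add_right h _), le_rfl]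

end Tests

section Trace

variable {n : Type*} [Fintype n]

theorem trace_mul_nonneg {A B : Matrix n n ℂ} (hA : A.PosSemidef) (hB : B.PosSemidef) :
    0 ≤ (A * B).trace := by
  obtain ⟨k, v, rfl⟩ := Matrix.posSemidef_iff_eq_sum_vecMulVec.1 hA
  rw [Matrix.trace_mul_comm, Matrix.mul_sum, Matrix.trace_sum]
  refine Finset.sum_nonneg fun i _ => ?_
  rw [Matrix.mul_vecMulVec, Matrix.trace_vecMulVec, dotProduct_comm]
  exact hB.dotProduct_mulVec_nonneg _

theorem trace_mul_le_trace_mul {A A' B : Matrix n n ℂ} (hA : A ≤ A') (hB : B.PosSemidef) :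
    (A * B).trace ≤ (A' * B).trace := by
  rw [← sub_nonneg, ← Matrix.trace_sub, ← Matrix.sub_mul]
  exact trace_mul_nonneg (Matrix.le_iff.1 hA) hB

theorem kronecker_le_kronecker {m n : Type*} [Finite m] [Finite n] {A A' : Matrix m m ℂ}
    {B B' : Matrix n n ℂ} (hA : A ≤ A') (hB : B ≤ B') (hA₀ : 0 ≤ A) (hB₀ : 0 ≤ B') :
    A ⊗ₖ B ≤ A' ⊗ₖ B' := by
  have hsub : A' ⊗ₖ B' - A ⊗ₖ B = (A' - A) ⊗ₖ B' + A ⊗ₖ (B' - B) := by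
    rw [sub_eq_iff_eq_add, add_assoc, ← kronecker_add, sub_add_cancel, ← add_kronecker,
      sub_add_cancel]
  rw [Matrix.le_iff, hsub]
  exact ((Matrix.le_iff.1 hA).kronecker hB₀.posSemidef).add
    (hA₀.posSemidef.kronecker (Matrix.le_iff.1 hB))

end Trace

section BothPass

variable {R₁ R₂ : Wires} {T₁ T₁' : Op R₁} {T₂ T₂' : Op R₂} {q : Op (R₁ ⊠ R₂)}

theorem bothPass_nonneg (h₁ : 0 ≤ T₁) (h₂ : 0 ≤ T₂) (hq : q.PosSemidef) : 0 ≤ bothPass T₁ T₂ q :=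
  (Complex.le_def.1 (trace_mul_nonneg (h₁.posSemidef.kronecker h₂.posSemidef) hq)).1

theorem bothPass_mono (h₁ : T₁ ≤ T₁') (h₂ : T₂ ≤ T₂') (h₁₀ : 0 ≤ T₁) (h₂₀ : 0 ≤ T₂')
    (hq : q.PosSemidef) : bothPass T₁ T₂ q ≤ bothPass T₁' T₂' q :=
  (Complex.le_def.1 (trace_mul_le_trace_mul (kronecker_le_kronecker h₁ h₂ h₁₀ h₂₀) hq)).1

/-- `bothPass` as a linear map on states. -/
def bothPassLin (T₁ : Op R₁) (T₂ : Op R₂) : Op (R₁ ⊠ R₂) →ₗ[ℝ] ℝ where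
  toFun := bothPass T₁ T₂
  map_add' p q := by simp only [bothPass, Matrix.mul_add, Matrix.trace_add, Complex.add_re]
  map_smul' r q := by
    simp only [bothPass, Matrix.mul_smul, Matrix.trace_smul, Complex.smul_re, RingHom.id_apply]

end BothPass

/-! ## The winning probability of the reduction -/

theorem avg_tensor {a b : Wires} (f : (a ⊠ b).val → ℝ) :
    avg f = avg fun y : b.val => avg fun x : a.val => f (x, y) := by
  have hsum : ∑ x, f x = ∑ y, ∑ x, f (x, y) := Fintype.sum_prod_type_right _
  rw [avg, card_tensor, hsum, Nat.cast_mul, _root_.mul_inv_rev, mul_assoc]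
  simp only [avg, ← Finset.mul_sum]

theorem avg_mono {w : Wires} {f g : w.val → ℝ} (h : ∀ r, f r ≤ g r) : avg f ≤ avg g :=
  mul_le_mul_of_nonneg_left (Finset.sum_le_sum fun r _ => h r) (inv_nonneg.2 (Nat.cast_nonneg _))

theorem avg_nonneg {w : Wires} {f : w.val → ℝ} (h : ∀ r, 0 ≤ f r) : 0 ≤ avg f :=
  mul_nonneg (inv_nonneg.2 (Nat.cast_nonneg _)) (Finset.sum_nonneg fun r _ => h r)

theorem posSemidef_condOn {a b : Wires} {ρ : Op (a ⊠ b)} (h : ρ.PosSemidef) (x : a.val) :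
    (condOn ρ x).PosSemidef :=
  h.submatrix _

theorem posSemidef_outputState {r b : Wires} (f : r.val → b.val) : (outputState f).PosSemidef :=
  (Matrix.posSemidef_sum _ fun _ _ => posSemidef_ket _).smul (inv_nonneg.2 (Nat.cast_nonneg _))

/-- The expected payoff of a measurement of the register `a` that is followed by a test on the
register `b`, where `V o` sends the unnormalized state after the outcome `o` to the payoff weighted
by the probability of `o`. -/
def expectation {a b : Wires} (V : a.val → Op b →ₗ[ℝ] ℝ) : Op (a ⊠ b) →ₗ[ℝ] ℝ where
  toFun ρ := ∑ o, V o (condOn ρ o)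
  map_add' ρ σ := by
    simp only [condOn, Matrix.submatrix_add, Pi.add_apply, map_add, Finset.sum_add_distrib]
  map_smul' z ρ := by
    simp only [condOn, Matrix.submatrix_smul, Pi.smul_apply, map_smul, Finset.smul_sum,
      RingHom.id_apply]

section Expectation

variable {a b : Wires} {V W : a.val → Op b →ₗ[ℝ] ℝ} {ρ : Op (a ⊠ b)}

theorem expectation_nonneg (h : ∀ o (q : Op b), q.PosSemidef → 0 ≤ V o q) (hρ : ρ.PosSemidef) :
    0 ≤ expectation V ρ :=
  Finset.sum_nonneg fun o _ => h o _ (posSemidef_condOn hρ o)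

theorem expectation_mono (h : ∀ o (q : Op b), q.PosSemidef → V o q ≤ W o q) (hρ : ρ.PosSemidef) :
    expectation V ρ ≤ expectation W ρ :=
  Finset.sum_le_sum fun o _ => h o _ (posSemidef_condOn hρ o)

theorem expectation_appendKey {fpk X D R : Wires}
    (V : (X ⊠ X ⊠ fpk ⊠ D).val → Op R →ₗ[ℝ] ℝ) (k : fpk.val) (τ : Op ((X ⊠ X ⊠ D) ⊠ R)) :
    expectation V ((appendKey fpk X D R).denote (ket k ⊗ₒ τ)) =
      expectation (a := X ⊠ X ⊠ D) (fun o => V (o.1, o.2.1, k, o.2.2)) τ := by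
  refine (Fintype.sum_of_injective
    (fun o : (X ⊠ X ⊠ D).val => ((o.1, o.2.1, k, o.2.2) : (X ⊠ X ⊠ fpk ⊠ D).val))
    ?_ _ _ ?_ ?_).symm
  · rintro ⟨x₀, x₁, d⟩ ⟨x₀', x₁', d'⟩ h
    cases h
    rfl
  · rintro ⟨x₀, x₁, k', d⟩ ho
    have hk : k ≠ k' := fun hk => ho ⟨(x₀, x₁, d), by rw [hk]⟩
    rw [condOn_denote_appendKey, ket, single_apply_of_ne _ _ _ _ _ fun h => hk h.1, zero_smul,
      map_zero]
  · rintro ⟨x₀, x₁, d⟩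
    rw [condOn_denote_appendKey, ket, single_apply_same, one_smul]

theorem expectation_avg_appendKey {r F fpk X D R : Wires}
    (V : (X ⊠ X ⊠ fpk ⊠ D).val → Op R →ₗ[ℝ] ℝ) (k : r.val → fpk.val)
    (τ : r.val → F.val → Op ((X ⊠ X ⊠ D) ⊠ R)) :
    expectation V ((Fintype.card r.val : ℂ)⁻¹ •
        ∑ s, (appendKey fpk X D R).denote (ket (k s) ⊗ₒ ∑ f, τ s f)) =
      avg fun s => ∑ f, expectation (a := X ⊠ X ⊠ D)
        (fun o => V (o.1, o.2.1, k s, o.2.2)) (τ s f) := by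
  rw [inv_natCast_smul_eq ℂ ℝ, map_smul, map_sum, smul_eq_mul, avg]
  exact congrArg _ (Fintype.sum_congr _ _ fun s =>
    (expectation_appendKey _ _ _).trans (map_sum _ _ _))

end Expectation

open Classical in
/-- The probability of passing both tests of the game of `SDEPirate.winProb`, as a function of the
classical output `o` of the adversary and of its unnormalized final state. -/
def SDEPirate.payoff {M : ℕ → Wires} {S : SDE M} {g : RandFamily M} (A : SDEPirate S g) (n : ℕ)
    (γ : ℝ) (pk : (S.pk n).val)
    (o : (g.dom n ⊠ g.dom n ⊠ g.key n ⊠ A.d₁ n ⊠ A.d₂ n).val) :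
    Op (A.R₁ n ⊠ A.R₂ n) →ₗ[ℝ] ℝ :=
  if o.1 ∈ g.inputs n ∧ o.2.1 ∈ g.inputs n ∧ o.2.2.1 ∈ g.keys n then
    bothPassLin
      (testProj (A.R₁ n) γ (S.challenge g n pk o.2.2.1 o.1 o.2.1) ((A.d₁ n).toBits o.2.2.2.1))
      (testProj (A.R₂ n) γ (S.challenge g n pk o.2.2.1 o.1 o.2.1) ((A.d₂ n).toBits o.2.2.2.2))
  else 0

theorem SDEPirate.winProb_eq {M : ℕ → Wires} {S : SDE M} {g : RandFamily M} (A : SDEPirate S g)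
    (n : ℕ) (γ : ℝ) :
    A.winProb n γ = avg fun r => expectation (A.payoff n γ (S.setup n r).1)
      ((A.run n).denote (ket (S.setup n r).1 ⊗ₒ S.qkg n (S.setup n r).2)) := by
  classical
  refine congrArg avg (funext fun r => Fintype.sum_congr _ _ fun o => ?_)
  unfold SDEPirate.payoff
  split_ifs with ho
  exacts [if_pos ho, if_neg ho]

section SDFEPirate

variable {𝓕 : FunClass} {S : SDFE 𝓕}

open Classical in
/-- The analogue of `SDEPirate.payoff` for the game of `SDFEPirate.winProb` with query `f`. -/
def SDFEPirate.payoff (A : SDFEPirate S) (n : ℕ) (γ : ℝ) (pk : (S.pk n).val) (f : (𝓕.F n).val)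
    (o : (𝓕.X n ⊠ 𝓕.X n ⊠ A.d₁ n ⊠ A.d₂ n).val) : Op (A.R₁ n ⊠ A.R₂ n) →ₗ[ℝ] ℝ :=
  if f ∈ 𝓕.functions n ∧ o.1 ∈ 𝓕.plaintexts n ∧ o.2.1 ∈ 𝓕.plaintexts n ∧
      𝓕.eval n f o.1 ≠ 𝓕.eval n f o.2.1 then
    bothPassLin
      (testProj (A.R₁ n) γ (S.challenge n pk o.1 o.2.1) ((A.d₁ n).toBits o.2.2.1))
      (testProj (A.R₂ n) γ (S.challenge n pk o.1 o.2.1) ((A.d₂ n).toBits o.2.2.2))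
  else 0

/-- The unnormalized final state of an adversary that makes the query `f`, if `r` is the randomness
of the setup. -/
def SDFEPirate.finalState (A : SDFEPirate S) (n : ℕ) (r : (S.setupRand n).val) (f : (𝓕.F n).val) :
    Op ((𝓕.X n ⊠ 𝓕.X n ⊠ A.d₁ n ⊠ A.d₂ n) ⊠ (A.R₁ n ⊠ A.R₂ n)) :=
  (A.run n).denote
    (condOn ((A.query n).denote (ket (S.setup n r).1)) f ⊗ₒ S.qkg n (S.setup n r).2 f)

theorem SDFEPirate.winProb_eq (A : SDFEPirate S) (n : ℕ) (γ : ℝ) :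
    A.winProb n γ = avg fun r =>
      ∑ f, expectation (A.payoff n γ (S.setup n r).1 f) (A.finalState n r f) := by
  classical
  refine congrArg avg (funext fun r => Fintype.sum_congr _ _ fun f =>
    Fintype.sum_congr _ _ fun o => ?_)
  unfold SDFEPirate.payoff
  split_ifs with ho
  exacts [if_pos ho, if_neg ho]

theorem SDFEPirate.payoff_nonneg (A : SDFEPirate S) (n : ℕ) (γ : ℝ) (pk : (S.pk n).val)
    (f : (𝓕.F n).val) (o : (𝓕.X n ⊠ 𝓕.X n ⊠ A.d₁ n ⊠ A.d₂ n).val) {q : Op (A.R₁ n ⊠ A.R₂ n)}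
    (hq : q.PosSemidef) : 0 ≤ A.payoff n γ pk f o q := by
  unfold SDFEPirate.payoff
  split_ifs
  exacts [bothPass_nonneg (testProj_nonneg _ _ _ _) (testProj_nonneg _ _ _ _) hq, le_rfl]

theorem SDFEPirate.posSemidef_finalState (A : SDFEPirate S) {n : ℕ}
    (hqkg : ∀ k f, (S.qkg n k f).PosSemidef) (r : (S.setupRand n).val) (f : (𝓕.F n).val) :
    (A.finalState n r f).PosSemidef :=
  (QCirc.isCP _).posSemidef <|
    (posSemidef_condOn ((QCirc.isCP _).posSemidef (posSemidef_ket _)) f).kronecker (hqkg _ f)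

theorem SDFEPirate.winProb_nonneg (A : SDFEPirate S) {n : ℕ}
    (hqkg : ∀ k f, (S.qkg n k f).PosSemidef) (γ : ℝ) : 0 ≤ A.winProb n γ := by
  rw [A.winProb_eq]
  exact avg_nonneg fun r => Finset.sum_nonneg fun f _ =>
    expectation_nonneg (fun o _ => A.payoff_nonneg n γ _ f o) (A.posSemidef_finalState hqkg r f)

end SDFEPirate

/-! ## Security of the nested scheme -/

section Nested

variable {𝓕 : FunClass} {C : ℕ → Wires} {fe : PKFE 𝓕 C} {sde : SDE C}

theorem qkg_nested (n : ℕ) (k : (fe.msk n).val) (k' : (sde.sk n).val) (f : (𝓕.F n).val) :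
    (nested fe sde).qkg n (k, k') f = outputState (fe.kg n k f) ⊗ₒ sde.qkg n k' := by
  rw [outputState, Op.smul_tensor, Op.sum_tensor]
  rfl

theorem posSemidef_qkg_nested {n : ℕ} (hqkg : ∀ k, (sde.qkg n k).PosSemidef)
    (k : ((nested fe sde).msk n).val) (f : (𝓕.F n).val) :
    ((nested fe sde).qkg n k f).PosSemidef := by
  rw [show k = (k.1, k.2) from rfl, qkg_nested]
  exact (posSemidef_outputState _).kronecker (hqkg _)

/-- The pirate against the single-decryptor encryption scheme that generates the functional
encryption keys itself and runs a pirate `A` against the nested scheme. -/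
def reductionPirate (A : SDFEPirate (nested fe sde))
    (setup : ∀ n, BCirc (.unit ⊠ fe.setupRand n) (fe.pk n ⊠ fe.msk n))
    (kg : ∀ n, BCirc ((fe.msk n ⊠ 𝓕.F n) ⊠ fe.kgRand n) (fe.sk n)) :
    SDEPirate sde fe.encFamily where
  d₁ := A.d₁
  d₂ := A.d₂
  R₁ := A.R₁
  R₂ := A.R₂
  run n := reduction (spk := sde.pk n) (dk := sde.dk n) (X := 𝓕.X n) (D := A.d₁ n ⊠ A.d₂ n)
    (R := A.R₁ n ⊠ A.R₂ n) (st := A.st n) (setup n) (kg n) (A.query n) (A.run n)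

variable (A : SDFEPirate (nested fe sde))
  {setup : ∀ n, BCirc (.unit ⊠ fe.setupRand n) (fe.pk n ⊠ fe.msk n)}
  {kg : ∀ n, BCirc ((fe.msk n ⊠ 𝓕.F n) ⊠ fe.kgRand n) (fe.sk n)}

theorem denote_run_reductionPirate (hsetup : ∀ n x s, (setup n).eval (x, s) = fe.setup n s)
    (hkg : ∀ n x s, (kg n).eval (x, s) = fe.kg n x.1 x.2 s) (n : ℕ) (r : (sde.setupRand n).val) :
    ((reductionPirate A setup kg).run n).denote
        (ket (sde.setup n r).1 ⊗ₒ sde.qkg n (sde.setup n r).2) =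
      (Fintype.card (fe.setupRand n).val : ℂ)⁻¹ • ∑ s, (appendKey _ _ _ _).denote
        (ket (fe.setup n s).1 ⊗ₒ ∑ f, A.finalState n (s, r) f) := by
  have hrun := denote_reduction (spk := sde.pk n) (dk := sde.dk n) (X := 𝓕.X n)
    (D := A.d₁ n ⊠ A.d₂ n) (R := A.R₁ n ⊠ A.R₂ n) (st := A.st n) (setup n) (kg n) (A.query n)
    (A.run n) (sde.setup n r).1 (sde.qkg n (sde.setup n r).2)
  simp only [hsetup, hkg] at hrun
  refine hrun.trans (congrArg (_ • ·) (Fintype.sum_congr _ _ fun s => ?_))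
  refine congrArg (fun τ => (appendKey _ _ _ _).denote (ket (fe.setup n s).1 ⊗ₒ τ))
    (Fintype.sum_congr _ _ fun f => ?_)
  exact congrArg (fun σ => (A.run n).denote
    (condOn ((A.query n).denote (ket ((nested fe sde).setup n (s, r)).1)) f ⊗ₒ σ))
    (qkg_nested n (fe.setup n s).2 (sde.setup n r).2 f).symm

theorem winProb_reductionPirate (hsetup : ∀ n x s, (setup n).eval (x, s) = fe.setup n s)
    (hkg : ∀ n x s, (kg n).eval (x, s) = fe.kg n x.1 x.2 s) (n : ℕ) (γ : ℝ) :
    (reductionPirate A setup kg).winProb n γ =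
      avg fun r : ((nested fe sde).setupRand n).val => ∑ f, expectation
        (fun o : (𝓕.X n ⊠ 𝓕.X n ⊠ A.d₁ n ⊠ A.d₂ n).val => (reductionPirate A setup kg).payoff n γ
          (sde.setup n r.2).1 (o.1, o.2.1, (fe.setup n r.1).1, o.2.2))
        (A.finalState n r f) := by
  rw [SDEPirate.winProb_eq]
  refine (congrArg avg (funext fun r => ?_)).trans (avg_tensor _).symm
  rw [denote_run_reductionPirate A hsetup hkg]
  exact expectation_avg_appendKey _ (fun s => (fe.setup n s).1) fun s => A.finalState n (s, r)

theorem payoff_le_payoff_reductionPirate {n : ℕ} {γ γ' : ℝ} (hγ : γ' ≤ γ) {pk : (fe.pk n).val}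
    (hpk : pk ∈ fe.encFamily.keys n) (pk' : (sde.pk n).val) (f : (𝓕.F n).val)
    (o : (𝓕.X n ⊠ 𝓕.X n ⊠ A.d₁ n ⊠ A.d₂ n).val) {q : Op (A.R₁ n ⊠ A.R₂ n)} (hq : q.PosSemidef) :
    A.payoff n γ (pk, pk') f o q ≤
      (reductionPirate A setup kg).payoff n γ' pk' (o.1, o.2.1, pk, o.2.2) q := by
  unfold SDFEPirate.payoff SDEPirate.payoff
  split_ifs with hf ho ho
  · exact bothPass_mono (testProj_antitone _ _ _ hγ) (testProj_antitone _ _ _ hγ)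
      (testProj_nonneg _ _ _ _) (testProj_nonneg _ _ _ _) hq
  · exact absurd ⟨hf.2.1, hf.2.2.1, hpk⟩ ho
  · exact bothPass_nonneg (testProj_nonneg _ _ _ _) (testProj_nonneg _ _ _ _) hq
  · exact le_rfl

theorem winProb_le_winProb_reductionPirate
    (hsetup : ∀ n x s, (setup n).eval (x, s) = fe.setup n s)
    (hkg : ∀ n x s, (kg n).eval (x, s) = fe.kg n x.1 x.2 s) {n : ℕ}
    (hqkg : ∀ k, (sde.qkg n k).PosSemidef) {γ γ' : ℝ} (hγ : γ' ≤ γ) :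
    A.winProb n γ ≤ (reductionPirate A setup kg).winProb n γ' := by
  rw [A.winProb_eq, winProb_reductionPirate A hsetup hkg]
  exact avg_mono fun r => Finset.sum_le_sum fun f _ => expectation_mono
    (fun o _ => payoff_le_payoff_reductionPirate A hγ ⟨r.1, rfl⟩ (sde.setup n r.2).1 f o)
    (A.posSemidef_finalState (posSemidef_qkg_nested hqkg) r f)

theorem isQPT_reductionPirate (hsetup : IsQPT fun n => sample (setup n))
    (hkg : IsQPT fun n => sample (kg n)) (hpk : PolyBounded fun n => (sde.pk n).width)
    (hdk : PolyBounded fun n => (sde.dk n).width) (hquery : IsQPT A.query) (hrun : IsQPT A.run) :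
    IsQPT (reductionPirate A setup kg).run :=
  (efficient_reduction hsetup hkg.efficient hquery.efficient hrun.efficient).isQPT (hpk.add hdk)

end Nested

theorem Negligible.of_le {f g : ℕ → ℝ} (hg : Negligible g) (hf : ∀ n, 0 ≤ f n)
    (hfg : ∀ n, f n ≤ g n) : Negligible f :=
  hg.trans_abs_le fun n => by
    rw [abs_of_nonneg (hf n), abs_of_nonneg ((hf n).trans (hfg n))]
    exact hfg n

namespace SDE.IsEfficient

variable {M : ℕ → Wires} {S : SDE M}

theorem polyBounded_width_pk (hS : S.IsEfficient) : PolyBounded fun n => (S.pk n).width := by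
  obtain ⟨_, _, henc⟩ := hS.enc
  exact henc.polyBounded_width_input.mono fun n =>
    (Nat.le_add_right (S.pk n).width (M n).width)

theorem polyBounded_width_dk (hS : S.IsEfficient) : PolyBounded fun n => (S.dk n).width := by
  obtain ⟨_, hQ, _⟩ := hS.qkg
  exact hQ.polyBounded_width_output

theorem posSemidef_qkg (hS : S.IsEfficient) (n : ℕ) (k : (S.sk n).val) :
    (S.qkg n k).PosSemidef := by
  obtain ⟨Q, _, hQ⟩ := hS.qkg
  rw [← hQ]
  exact (Q n).isCP.posSemidef (posSemidef_ket k)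

end SDE.IsEfficient

end QCrypto

end

open scoped ComplexOrder in
theorem mainTheorem9_general {𝓕 : QCrypto.FunClass} {C : ℕ → QCrypto.Wires}
    {fe : QCrypto.PKFE 𝓕 C} {sde : QCrypto.SDE C}
    (hsetup : QCrypto.IsPPT (a := fun _ => .unit) (b := fun n => fe.pk n ⊠ fe.msk n)
      fun n _ r => fe.setup n r)
    (hkg : QCrypto.IsPPT (a := fun n => .tensor (fe.msk n) (𝓕.F n)) fun n x r => fe.kg n x.1 x.2 r)
    (hpk : QCrypto.PolyBounded fun n => (sde.pk n).width)
    (hdk : QCrypto.PolyBounded fun n => (sde.dk n).width)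
    (hqkg : ∀ n k, (sde.qkg n k).PosSemidef) {γ γ' : ℕ → ℝ} (hγ : ∀ n, γ' n ≤ γ n)
    (h : sde.StrongAntiPiracyRand fe.encFamily γ') :
    (QCrypto.nested fe sde).ChallengeOnlyStrongAntiPiracy γ := by
  intro A hquery hrun
  obtain ⟨setup, hsetup_eval, hsetup_qpt⟩ := hsetup
  obtain ⟨kg, hkg_eval, hkg_qpt⟩ := hkg
  have hwin := h _ (QCrypto.isQPT_reductionPirate A hsetup_qpt hkg_qpt hpk hdk hquery hrun)
  exact hwin.of_le (fun n => A.winProb_nonneg (QCrypto.posSemidef_qkg_nested (hqkg n)) (γ n))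
    fun n => QCrypto.winProb_le_winProb_reductionPirate A hsetup_eval hkg_eval (hqkg n) (hγ n)

theorem mainTheorem9 (𝓕 : QCrypto.FunClass) (C : ℕ → QCrypto.Wires)
    (fe : QCrypto.PKFE 𝓕 C) (sde : QCrypto.SDE C)
    (hfe : fe.IsEfficient) (hsde : sde.IsEfficient)
    (γ γ' : ℕ → ℝ) (hγ : ∀ n, 0 ≤ γ' n ∧ γ' n ≤ γ n ∧ γ n ≤ 1)
    (h : sde.StrongAntiPiracyRand fe.encFamily γ') :
    (QCrypto.nested fe sde).ChallengeOnlyStrongAntiPiracy γ :=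
  mainTheorem9_general hfe.setup hfe.kg hsde.polyBounded_width_pk hsde.polyBounded_width_dk
    hsde.posSemidef_qkg (fun n => (hγ n).2.1) h
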